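/- Let $K$ and $T$ be affine (linear) algebraic groups over $\mathbb C$ with Lie algebras $\mathfrak k$ and $\mathfrak t$, and let $\gamma:T\to K$ be a morphism of algebraic groups whose differential $\mathfrak t\to\mathfrak k$ is injective; regard $\mathfrak t$ as a subalgebra of $\mathfrak k$. Let $T$ act on $\mathfrak k$, on the enveloping algebra $\mathcal U(\mathfrak k)$ and on $\bigwedge\mathfrak k$ through $\mathrm{Ad}\circ\gamma$. A $(\mathfrak k,T,N(\mathfrak t))$-module (equivalently, an equivariant $(\mathcal U(\mathfrak k),T)$-complex) is a complex $(V,d)$ of complex vector spaces with an action $\pi$ of $\mathcal U(\mathfrak k)$ and an algebraic action $\nu$ of $T$, both by chain maps, such that $\pi(\mathrm{Ad}(t)a)=\nu(t)\pi(a)\nu(t)^{-1}$, together with operators $i_\xi$ of degree $-1$, linear in $\xi\in\mathfrak t$, such that $i_\xi\pi(a)=\pi(a)i_\xi$, $i_{\mathrm{Ad}(t)\xi}=\nu(t)i_\xi\nu(t)^{-1}$, $i_\xi i_\eta+i_\eta i_\xi=0$ and $d\,i_\xi+i_\xi d=\nu(\xi)-\pi(\xi)$, where $\nu(\xi)$ is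 given by the differential of $\nu$. (The differential graded algebra $N(\mathfrak t)$ acts through $\xi\mapsto\nu(\xi)-\pi(\xi)$ in degree $0$ and $\xi\mapsto i_\xi$ in degree $-1$.) Morphisms are chain maps that commute with all the actions. Two morphisms $f,g:V\to W$ are homotopic if $f-g=hd+dh$ for a linear map $h:V\to W$ of degree $-1$ that commutes with $\pi$ and $\nu$ and anticommutes with all $i_\xi$. A module $V$ is K-projective if every morphism from $V$ to an acyclic module is homotopic to $0$. The standard complex is $N^{-p}(\mathfrak k)=\mathcal U(\mathfrak k)\otimes\bigwedge^{p}\mathfrak k$ with $$d(u\otimes\lambda_1\wedge\dots\wedge\lambda_p)=\sum_{i}(-1)^{i-1}u\lambda_i\otimes\lambda_1\wedge\dots\widehat{\lambda_i}\dots\wedge\lambda_p+\sum_{j<i}(-1)^{i+j}u\otimes[\lambda_j,\lambda_i]\wedge\lambda_1\wedge\dots\widehat{\lambda_j}\dots\widehat{\lambda_i}\dots\wedge\lambda_p .$$ Let $\mathcal U(\mathfrak k)$ act on it by left multiplication in the first factor, $T$ by the adjoint action on both factors, and put $i_\xi(u\otimes\mu)=-(-1)^{p}\,u\otimes\mu\wedge\xi=-u\otimes\xi\wedge\mu$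 for $\mu\in\bigwedge^p\mathfrak k$, $\xi\in\mathfrak t$ (right multiplication by $N(\mathfrak t)$ turned into a left action). Theorem. Suppose that $T$ is reductive, i.e. every finite-dimensional algebraic representation of $T$ is completely reducible ($T$ need not be connected). Then $N(\mathfrak k)$, with these operations, is a $(\mathfrak k,T,N(\mathfrak t))$-module, and it is K-projective. -/

import Mathlib

open scoped TensorProduct

universe u v w

noncomputable section

/-! ### Affine algebraic groups over the complex numbers -/

/-- An affine (equivalently: linear) algebraic group over `ℂ`, in classical terms: a group `G` with
a finitely generated algebra `regular` of complex valued functions on it, the regular functions,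
such that the points of `G` are exactly the characters of that algebra (so `G` is an affine variety)
and such that multiplication and inversion are morphisms of varieties. -/
class AffineAlgebraicGroup (G : Type u) [Group G] where
  /-- the regular functions -/
  regular : Subalgebra ℂ (G → ℂ)
  fg : regular.FG
  eval_bijective : Function.Bijective
    (fun g : G => ((Pi.evalAlgHom ℂ (fun _ : G => ℂ) g).comp regular.val : regular →ₐ[ℂ] ℂ))
  mul_regular : ∀ f ∈ regular, ∃ (n : ℕ) (a b : Fin n → G → ℂ), (∀ i, a i ∈ regular) ∧
    (∀ i, b i ∈ regular) ∧ ∀ x y, f (x * y) = ∑ i, a i x * b i y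
  inv_regular : ∀ f ∈ regular, (fun x => f x⁻¹) ∈ regular

namespace AffineAlgebraicGroup

section Basic

variable (G : Type u) [Group G] [AffineAlgebraicGroup G]

/-- The algebra of regular functions, as a type. -/
abbrev Reg : Type u := (regular : Subalgebra ℂ (G → ℂ))

variable {G}

theorem left_mem (g : G) (f : Reg G) : (fun x => (f : G → ℂ) (g * x)) ∈ (regular (G := G)) := by
  obtain ⟨n, a, b, -, hb, h⟩ := mul_regular _ f.2
  have : (fun x => (f : G → ℂ) (g * x)) = ∑ i, a i g • b i := by
    funext x; simp [h]
  rw [this]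
  exact Subalgebra.sum_mem _ fun i _ => Subalgebra.smul_mem _ (hb i) _

theorem right_mem (g : G) (f : Reg G) : (fun x => (f : G → ℂ) (x * g)) ∈ (regular (G := G)) := by
  obtain ⟨n, a, b, ha, -, h⟩ := mul_regular _ f.2
  have : (fun x => (f : G → ℂ) (x * g)) = ∑ i, b i g • a i := by
    funext x; simp [h, mul_comm]
  rw [this]
  exact Subalgebra.sum_mem _ fun i _ => Subalgebra.smul_mem _ (ha i) _

/-- `(leftTranslate g f) x = f (g x)`. -/
def leftTranslate (g : G) : Reg G →ₐ[ℂ] Reg G where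
  toFun f := ⟨fun x => (f : G → ℂ) (g * x), left_mem g f⟩
  map_one' := rfl
  map_mul' _ _ := rfl
  map_zero' := rfl
  map_add' _ _ := rfl
  commutes' _ := rfl

/-- `(rightTranslate g f) x = f (x g)`. -/
def rightTranslate (g : G) : Reg G →ₐ[ℂ] Reg G where
  toFun f := ⟨fun x => (f : G → ℂ) (x * g), right_mem g f⟩
  map_one' := rfl
  map_mul' _ _ := rfl
  map_zero' := rfl
  map_add' _ _ := rfl
  commutes' _ := rfl

theorem leftTranslate_apply (g : G) (f : Reg G) (x : G) :
    (leftTranslate g f : G → ℂ) x = (f : G → ℂ) (g * x) := rfl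

theorem rightTranslate_apply (g : G) (f : Reg G) (x : G) :
    (rightTranslate g f : G → ℂ) x = (f : G → ℂ) (x * g) := rfl

theorem left_right (g h : G) (f : Reg G) :
    leftTranslate g (rightTranslate h f) = rightTranslate h (leftTranslate g f) := by
  apply Subtype.ext; funext x; simp [leftTranslate_apply, rightTranslate_apply, mul_assoc]

theorem right_right (g h : G) (f : Reg G) :
    rightTranslate g (rightTranslate h f) = rightTranslate (g * h) f := by
  apply Subtype.ext; funext x; simp [rightTranslate_apply, mul_assoc]

theorem right_one (f : Reg G) : rightTranslate 1 f = f := by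
  apply Subtype.ext; funext x; simp [rightTranslate_apply]

variable (G)

/-- The left invariant derivations of the algebra of regular functions, with the commutator
bracket. -/
def leftInvariant : LieSubalgebra ℂ (Derivation ℂ (Reg G) (Reg G)) where
  carrier := {D | ∀ (g : G) (f : Reg G), D (leftTranslate g f) = leftTranslate g (D f)}
  add_mem' {D E} hD hE g f := by
    rw [Derivation.add_apply, Derivation.add_apply, hD g f, hE g f, map_add]
  zero_mem' g f := by rw [Derivation.zero_apply, Derivation.zero_apply, map_zero]
  smul_mem' c D hD g f := by
    rw [Derivation.smul_apply, Derivation.smul_apply, hD g f, map_smul]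
  lie_mem' {D E} hD hE g f := by
    rw [Derivation.commutator_apply, Derivation.commutator_apply, map_sub, hD g f, hE g f, hD, hE]

/-- The Lie algebra of `G`: the left invariant derivations of the algebra of regular functions,
with the commutator bracket. -/
def LieAlg : Type u := leftInvariant G

instance : LieRing (LieAlg G) := inferInstanceAs (LieRing (leftInvariant G))

instance : LieAlgebra ℂ (LieAlg G) := inferInstanceAs (LieAlgebra ℂ (leftInvariant G))

variable {G}

/-- An element of the Lie algebra, as a derivation. -/
def LieAlg.der (X : LieAlg G) : Derivation ℂ (Reg G) (Reg G) := Subtype.val X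

/-- A left invariant derivation, as an element of the Lie algebra. -/
def LieAlg.mk (D : Derivation ℂ (Reg G) (Reg G))
    (h : ∀ (g : G) (f : Reg G), D (leftTranslate g f) = leftTranslate g (D f)) : LieAlg G :=
  ⟨D, h⟩

theorem LieAlg.der_left (X : LieAlg G) (g : G) (f : Reg G) :
    X.der (leftTranslate g f) = leftTranslate g (X.der f) := Subtype.property X g f

theorem LieAlg.der_add (X Y : LieAlg G) (f : Reg G) : (X + Y).der f = X.der f + Y.der f := rfl

theorem LieAlg.der_smul (c : ℂ) (X : LieAlg G) (f : Reg G) : (c • X).der f = c • X.der f := rfl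

theorem LieAlg.der_lie (X Y : LieAlg G) (f : Reg G) :
    ⁅X, Y⁆.der f = X.der (Y.der f) - Y.der (X.der f) :=
  Derivation.commutator_apply (D1 := X.der) (D2 := Y.der) (a := f)

theorem LieAlg.ext {X Y : LieAlg G} (h : ∀ f, X.der f = Y.der f) : X = Y :=
  Subtype.ext (Derivation.ext h)

/-- The value at the identity of the derivative of `f` along `X`. -/
def tangent (X : LieAlg G) : Reg G →ₗ[ℂ] ℂ where
  toFun f := (X.der f : G → ℂ) 1
  map_add' f g := by rw [map_add]; rfl
  map_smul' c f := by rw [Derivation.map_smul]; rfl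

theorem tangent_apply (X : LieAlg G) (f : Reg G) : tangent X f = (X.der f : G → ℂ) 1 := rfl

theorem apply_eq_tangent (X : LieAlg G) (f : Reg G) (x : G) :
    (X.der f : G → ℂ) x = tangent X (leftTranslate x f) := by
  rw [tangent_apply, X.der_left x f, leftTranslate_apply, mul_one]

theorem ext_tangent {X Y : LieAlg G} (h : ∀ f, tangent X f = tangent Y f) : X = Y := by
  apply LieAlg.ext; intro f; apply Subtype.ext; funext x
  rw [apply_eq_tangent, apply_eq_tangent, h]

theorem tangent_add (X Y : LieAlg G) (f : Reg G) :
    tangent (X + Y) f = tangent X f + tangent Y f := rfl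

theorem tangent_smul (c : ℂ) (X : LieAlg G) (f : Reg G) :
    tangent (c • X) f = c * tangent X f := rfl

/-- The derivation `rightTranslate g ∘ X ∘ rightTranslate g⁻¹`. -/
def AdFun (g : G) (X : LieAlg G) : LieAlg G :=
  LieAlg.mk (Derivation.mk'
      ((rightTranslate g).toLinearMap ∘ₗ X.der.toLinearMap ∘ₗ (rightTranslate g⁻¹).toLinearMap)
      (fun a b => by
        change rightTranslate g (X.der (rightTranslate g⁻¹ (a * b))) =
          a * rightTranslate g (X.der (rightTranslate g⁻¹ b)) +
          b * rightTranslate g (X.der (rightTranslate g⁻¹ a))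
        rw [map_mul, Derivation.leibniz]
        simp only [smul_eq_mul, map_add, map_mul, right_right, mul_inv_cancel, right_one]))
    (fun h f => by
      change rightTranslate g (X.der (rightTranslate g⁻¹ (leftTranslate h f))) =
        leftTranslate h (rightTranslate g (X.der (rightTranslate g⁻¹ f)))
      rw [← left_right, X.der_left, left_right])

theorem AdFun_apply (g : G) (X : LieAlg G) (f : Reg G) :
    (AdFun g X).der f = rightTranslate g (X.der (rightTranslate g⁻¹ f)) := rfl

/-- The adjoint action of `G` on its Lie algebra:
`Ad g X = rightTranslate g ∘ X ∘ rightTranslate g⁻¹`. -/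
def Ad (g : G) : LieAlg G →ₗ⁅ℂ⁆ LieAlg G where
  toFun X := AdFun g X
  map_add' X Y := LieAlg.ext fun f => by
    rw [LieAlg.der_add, AdFun_apply, AdFun_apply, AdFun_apply, LieAlg.der_add, map_add]
  map_smul' c X := LieAlg.ext fun f => by
    rw [RingHom.id_apply, LieAlg.der_smul, AdFun_apply, AdFun_apply, LieAlg.der_smul, map_smul]
  map_lie' {X Y} := LieAlg.ext fun f => by
    rw [LieAlg.der_lie]
    simp only [AdFun_apply, right_right, inv_mul_cancel, right_one]
    rw [LieAlg.der_lie, map_sub]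

theorem Ad_apply (g : G) (X : LieAlg G) (f : Reg G) :
    (Ad g X).der f = rightTranslate g (X.der (rightTranslate g⁻¹ f)) := rfl

theorem Ad_one (X : LieAlg G) : Ad (1 : G) X = X :=
  LieAlg.ext fun f => by rw [Ad_apply, inv_one, right_one, right_one]

theorem Ad_mul (g h : G) (X : LieAlg G) : Ad (g * h) X = Ad g (Ad h X) :=
  LieAlg.ext fun f => by
    rw [Ad_apply, Ad_apply, Ad_apply, right_right, right_right, mul_inv_rev]

/-! ### Algebraic representations and reductive groups -/

/-- The matrix coefficient `g ↦ φ (ρ g x)` of a representation. -/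
def coeff {V : Type v} [AddCommGroup V] [Module ℂ V] (ρ : Representation ℂ G V)
    (φ : Module.Dual ℂ V) (x : V) : G → ℂ := fun g => φ (ρ g x)

/-- A representation is algebraic if the space is the union of finite dimensional invariant
subspaces on which the group acts with regular matrix coefficients. -/
def IsAlgebraic {V : Type v} [AddCommGroup V] [Module ℂ V] (ρ : Representation ℂ G V) : Prop :=
  ∀ x : V, ∃ F : Submodule ℂ V, x ∈ F ∧ FiniteDimensional ℂ F ∧
    (∀ g, ∀ y ∈ F, ρ g y ∈ F) ∧
    ∀ y ∈ F, ∀ φ : Module.Dual ℂ V, coeff ρ φ y ∈ (regular (G := G))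

/-- `ρ'` is the differential of the representation `ρ`:
`φ (ρ' X x)` is the derivative at the identity along `X` of `g ↦ φ (ρ g x)`, for all linear
functionals `φ`. For an algebraic `ρ` all these coefficients are regular, and `ρ'` is unique. -/
def IsDifferential {V : Type v} [AddCommGroup V] [Module ℂ V] (ρ : Representation ℂ G V)
    (ρ' : LieAlg G → V → V) : Prop :=
  ∀ (X : LieAlg G) (x : V) (φ : Module.Dual ℂ V) (h : coeff ρ φ x ∈ (regular (G := G))),
    φ (ρ' X x) = tangent X ⟨coeff ρ φ x, h⟩

variable (G)

/-- `G` is reductive: every finite dimensional algebraic representation is completely reducible,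
i.e. every invariant subspace has an invariant complement. -/
def IsReductive : Prop :=
  ∀ (V : Type) [AddCommGroup V] [Module ℂ V] [FiniteDimensional ℂ V] (ρ : Representation ℂ G V),
    IsAlgebraic ρ → ∀ F : Submodule ℂ V, (∀ g, ∀ y ∈ F, ρ g y ∈ F) →
      ∃ F' : Submodule ℂ V, (∀ g, ∀ y ∈ F', ρ g y ∈ F') ∧ IsCompl F F'

end Basic

/-! ### Morphisms of algebraic groups and their differentials -/

/-- A morphism of algebraic groups: a homomorphism that pulls regular functions back to regular
functions. -/
structure Hom (T : Type u) (K : Type v) [Group T] [AffineAlgebraicGroup T] [Group K]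
    [AffineAlgebraicGroup K] extends T →* K where
  comp_regular : ∀ f ∈ (regular (G := K)), (fun t => f (toFun t)) ∈ (regular (G := T))

section Differential

variable {T : Type u} {K : Type v} [Group T] [AffineAlgebraicGroup T] [Group K]
  [AffineAlgebraicGroup K] (γ : Hom T K)

/-- Pull-back of regular functions. -/
def Hom.pullback : Reg K →ₐ[ℂ] Reg T where
  toFun f := ⟨fun t => (f : K → ℂ) (γ.toMonoidHom t), γ.comp_regular _ f.2⟩
  map_one' := rfl
  map_mul' _ _ := rfl
  map_zero' := rfl
  map_add' _ _ := rfl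
  commutes' _ := rfl

theorem Hom.pullback_apply (f : Reg K) (t : T) :
    (γ.pullback f : T → ℂ) t = (f : K → ℂ) (γ.toMonoidHom t) := rfl

theorem Hom.pullback_left (t : T) (f : Reg K) :
    γ.pullback (leftTranslate (γ.toMonoidHom t) f) = leftTranslate t (γ.pullback f) := by
  apply Subtype.ext; funext s
  simp [Hom.pullback_apply, leftTranslate_apply]

theorem Hom.diff_mem (X : LieAlg T) (f : Reg K) :
    (fun x => tangent X (γ.pullback (leftTranslate x f))) ∈ (regular (G := K)) := by
  obtain ⟨n, a, b, ha, hb, h⟩ := mul_regular _ f.2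
  have : (fun x => tangent X (γ.pullback (leftTranslate x f))) =
      ∑ i, tangent X (γ.pullback ⟨b i, hb i⟩) • a i := by
    funext x
    have hx : leftTranslate x f = ∑ i, a i x • (⟨b i, hb i⟩ : Reg K) := by
      apply Subtype.ext; funext y
      simp [leftTranslate_apply, h]
    rw [hx]
    simp only [map_sum, map_smul, Finset.sum_apply, Pi.smul_apply, smul_eq_mul, mul_comm]
  rw [this]
  exact Subalgebra.sum_mem _ fun i _ => Subalgebra.smul_mem _ (ha i) _

/-- The left invariant derivation of `Reg K` whose tangent vector is the image of that of `X`. -/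
def Hom.diffFun (X : LieAlg T) : LieAlg K :=
  LieAlg.mk (Derivation.mk'
    { toFun := fun f => (⟨fun x => tangent X (γ.pullback (leftTranslate x f)),
        γ.diff_mem X f⟩ : Reg K)
      map_add' := fun f g => by
        apply Subtype.ext; funext x
        change tangent X (γ.pullback (leftTranslate x (f + g))) =
          tangent X (γ.pullback (leftTranslate x f)) + tangent X (γ.pullback (leftTranslate x g))
        rw [map_add, map_add, map_add]
      map_smul' := fun c f => by
        apply Subtype.ext; funext x
        change tangent X (γ.pullback (leftTranslate x (c • f))) =
          c • tangent X (γ.pullback (leftTranslate x f))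
        rw [map_smul, map_smul, map_smul] }
    (fun f g => by
      apply Subtype.ext; funext x
      change tangent X (γ.pullback (leftTranslate x (f * g))) =
        (f : K → ℂ) x * tangent X (γ.pullback (leftTranslate x g)) +
        (g : K → ℂ) x * tangent X (γ.pullback (leftTranslate x f))
      have h1 : ∀ k : Reg K, (γ.pullback (leftTranslate x k) : T → ℂ) 1 = (k : K → ℂ) x := by
        intro k; rw [Hom.pullback_apply, map_one, leftTranslate_apply, mul_one]
      rw [map_mul, map_mul, tangent_apply, Derivation.leibniz]
      change (γ.pullback (leftTranslate x f) : T → ℂ) 1 * tangent X _ +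
        (γ.pullback (leftTranslate x g) : T → ℂ) 1 * tangent X _ = _
      rw [h1, h1]))
   (fun g f => by
      apply Subtype.ext; funext x
      have h : leftTranslate x (leftTranslate g f) = leftTranslate (g * x) f := by
        apply Subtype.ext; funext y; simp only [leftTranslate_apply, mul_assoc]
      change tangent X (γ.pullback (leftTranslate x (leftTranslate g f))) =
        tangent X (γ.pullback (leftTranslate (g * x) f))
      rw [h])

theorem Hom.diffFun_apply (X : LieAlg T) (f : Reg K) (x : K) :
    ((γ.diffFun X).der f : K → ℂ) x = tangent X (γ.pullback (leftTranslate x f)) := rfl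

theorem Hom.tangent_diffFun (X : LieAlg T) (f : Reg K) :
    tangent (γ.diffFun X) f = tangent X (γ.pullback f) := by
  rw [tangent_apply, Hom.diffFun_apply]
  congr 2
  apply Subtype.ext; funext y; simp [leftTranslate_apply]

theorem Hom.pullback_diffFun (X : LieAlg T) (f : Reg K) :
    γ.pullback ((γ.diffFun X).der f) = X.der (γ.pullback f) := by
  apply Subtype.ext; funext t
  rw [Hom.pullback_apply, Hom.diffFun_apply, Hom.pullback_left, apply_eq_tangent]

/-- The differential of a morphism of algebraic groups; its tangent vectors are
`f ↦ X (f ∘ γ) 1` (see `Hom.tangent_diffFun`). -/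
def Hom.diff : LieAlg T →ₗ⁅ℂ⁆ LieAlg K where
  toFun := γ.diffFun
  map_add' X Y := by
    apply ext_tangent; intro f
    rw [Hom.tangent_diffFun]
    simp only [tangent_add, Hom.tangent_diffFun]
  map_smul' c X := by
    apply ext_tangent; intro f
    rw [Hom.tangent_diffFun]
    simp only [tangent_smul, Hom.tangent_diffFun, RingHom.id_apply]
  map_lie' {X Y} := by
    apply ext_tangent; intro f
    rw [Hom.tangent_diffFun, tangent_apply, LieAlg.der_lie, tangent_apply, LieAlg.der_lie,
      ← Hom.pullback_diffFun, ← Hom.pullback_diffFun, ← Hom.pullback_diffFun,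
      ← Hom.pullback_diffFun, ← map_sub, Hom.pullback_apply, map_one]

end Differential

end AffineAlgebraicGroup

/-! ### The standard complex of a Lie algebra -/

namespace StandardComplex

section Standard

variable (L : Type u) [LieRing L] [LieAlgebra ℂ L]

/-- The enveloping algebra. -/
abbrev U : Type u := UniversalEnvelopingAlgebra ℂ L

/-- The exterior algebra of the underlying vector space. -/
abbrev Ext : Type u := ExteriorAlgebra ℂ L

/-- The total space `U(L) ⊗ ⋀ L` of the standard complex. -/
abbrev Space : Type u := U L ⊗[ℂ] Ext L

variable {L}

/-- `L → U(L)` as a linear map. -/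
def inc : L →ₗ[ℂ] U L where
  toFun x := UniversalEnvelopingAlgebra.ι ℂ x
  map_add' x y := map_add _ x y
  map_smul' c x := map_smul _ c x

/-- `L → ⋀ L`. -/
abbrev ex : L →ₗ[ℂ] Ext L := ExteriorAlgebra.ι ℂ

variable (L)

/-- The term of degree `n`: it is `U(L) ⊗ ⋀ᵖ L` if `n = -p` with `p : ℕ`, and zero if `n > 0`. -/
def gr (n : ℤ) : Submodule ℂ (Space L) :=
  Submodule.span ℂ {z | ∃ (p : ℕ) (a : U L) (μ : Ext L), n = -(p : ℤ) ∧
    μ ∈ ⋀[ℂ]^p L ∧ z = a ⊗ₜ[ℂ] μ}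

/-- One step of the recursion for the adjoint action on `⋀ L`. -/
def adStep : L →ₗ[ℂ] (Ext L × (L →ₗ[ℂ] Ext L)) →ₗ[ℂ] (L →ₗ[ℂ] Ext L) :=
  LinearMap.mk₂ ℂ
    (fun y q => LinearMap.mk (AddHom.mk (fun x => ex ⁅x, y⁆ * q.1 + ex y * q.2 x)
      (fun x x' => by simp only [add_lie, map_add, add_mul, mul_add]; abel))
      (fun c x => by simp [smul_add]))
    (fun y y' q => by
      ext x; simp only [LinearMap.coe_mk, AddHom.coe_mk, LinearMap.add_apply, lie_add, map_add,
        add_mul]; abel)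
    (fun c y q => by ext x; simp [smul_add])
    (fun y q q' => by
      ext x; simp only [LinearMap.coe_mk, AddHom.coe_mk, LinearMap.add_apply, Prod.fst_add,
        Prod.snd_add, mul_add]; abel)
    (fun c y q => by ext x; simp [smul_add])

theorem adStep_apply (x y : L) (μ : Ext L) (A : L →ₗ[ℂ] Ext L) :
    adStep L y (μ, A) x = ex ⁅x, y⁆ * μ + ex y * A x := rfl

theorem adStep_adStep (y : L) (μ : Ext L) (A : L →ₗ[ℂ] Ext L) :
    adStep L y (ex y * μ, adStep L y (μ, A)) = (0 : QuadraticForm ℂ L) y • A := by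
  ext x
  rw [adStep_apply, adStep_apply]
  rw [mul_add, ← mul_assoc, ← mul_assoc, ← mul_assoc, ExteriorAlgebra.ι_sq_zero, ← add_assoc,
    ← add_mul, ExteriorAlgebra.ι_add_mul_swap]
  simp

/-- The adjoint action on `⋀ L` as a map `μ ↦ (x ↦ ad x μ)`: `ad x` is the derivation that extends
`y ↦ ⁅x, y⁆` (see `ad_one` and `ad_mul`). -/
def ad : Ext L →ₗ[ℂ] (L →ₗ[ℂ] Ext L) :=
  CliffordAlgebra.foldr' (0 : QuadraticForm ℂ L) (adStep L) (adStep_adStep L) 0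

variable {L}

theorem ad_one (x : L) : ad L 1 x = 0 := by
  have h := CliffordAlgebra.foldr'_algebraMap (Q := (0 : QuadraticForm ℂ L)) (adStep L)
    (adStep_adStep L) 0 1
  rw [map_one] at h
  have h' : ad L 1 = (1 : ℂ) • (0 : L →ₗ[ℂ] Ext L) := h
  rw [h']; simp

theorem ad_mul (x y : L) (μ : Ext L) :
    ad L (ex y * μ) x = ex ⁅x, y⁆ * μ + ex y * ad L μ x := by
  have h : ad L (ex y * μ) = adStep L y (μ, ad L μ) :=
    CliffordAlgebra.foldr'_ι_mul (Q := (0 : QuadraticForm ℂ L)) (adStep L) (adStep_adStep L) 0 y μ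
  rw [h, adStep_apply]

/-- `wedge x (a ⊗ μ) = a ⊗ (x ∧ μ)`. -/
def wedge : L →ₗ[ℂ] Module.End ℂ (Space L) where
  toFun x := LinearMap.lTensor (U L) (LinearMap.mulLeft ℂ (ex x))
  map_add' x y := by
    rw [← LinearMap.lTensor_add]; congr 1; ext μ; simp [add_mul]
  map_smul' c x := by
    rw [RingHom.id_apply, ← LinearMap.lTensor_smul]; congr 1; ext μ; simp

theorem wedge_tmul (x : L) (a : U L) (μ : Ext L) : wedge x (a ⊗ₜ[ℂ] μ) = a ⊗ₜ[ℂ] (ex x * μ) := rfl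

theorem wedge_wedge (x : L) (z : Space L) : wedge x (wedge x z) = 0 := by
  induction z using TensorProduct.induction_on with
  | zero => simp
  | tmul a μ => rw [wedge_tmul, wedge_tmul, ← mul_assoc, ExteriorAlgebra.ι_sq_zero]; simp
  | add z z' h h' => rw [map_add, map_add, h, h', add_zero]

variable (L)

/-- One step of the recursion for the differential. -/
def dStep : L →ₗ[ℂ] (Ext L × (U L →ₗ[ℂ] Space L)) →ₗ[ℂ] (U L →ₗ[ℂ] Space L) :=
  LinearMap.mk₂ ℂ
    (fun x q => (TensorProduct.mk ℂ (U L) (Ext L)).flip q.1 ∘ₗ LinearMap.mulRight ℂ (inc x)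
      - (TensorProduct.mk ℂ (U L) (Ext L)).flip (ad L q.1 x) - wedge x ∘ₗ q.2)
    (fun x x' q => by
      ext a
      simp only [LinearMap.sub_apply, LinearMap.add_apply, LinearMap.comp_apply,
        LinearMap.flip_apply, TensorProduct.mk_apply, LinearMap.mulRight_apply, map_add, mul_add]
      abel)
    (fun c x q => by
      ext a
      simp only [LinearMap.sub_apply, LinearMap.smul_apply, LinearMap.comp_apply,
        LinearMap.flip_apply, TensorProduct.mk_apply, LinearMap.mulRight_apply, map_smul, smul_sub,
        mul_smul_comm, TensorProduct.smul_tmul'])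
    (fun x q q' => by
      ext a
      simp only [LinearMap.sub_apply, LinearMap.add_apply, LinearMap.comp_apply, Prod.fst_add,
        Prod.snd_add, LinearMap.flip_apply, TensorProduct.mk_apply, LinearMap.mulRight_apply,
        map_add]
      abel)
    (fun c x q => by
      ext a
      simp only [LinearMap.sub_apply, LinearMap.smul_apply, LinearMap.comp_apply, Prod.smul_fst,
        Prod.smul_snd, LinearMap.flip_apply, TensorProduct.mk_apply, LinearMap.mulRight_apply,
        map_smul, smul_sub])

theorem dStep_apply (x : L) (μ : Ext L) (D : U L →ₗ[ℂ] Space L) (a : U L) :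
    dStep L x (μ, D) a = (a * inc x) ⊗ₜ[ℂ] μ - a ⊗ₜ[ℂ] (ad L μ x) - wedge x (D a) := rfl

theorem dStep_dStep (x : L) (μ : Ext L) (D : U L →ₗ[ℂ] Space L) :
    dStep L x (ex x * μ, dStep L x (μ, D)) = (0 : QuadraticForm ℂ L) x • D := by
  ext a
  rw [dStep_apply, dStep_apply, map_sub, map_sub, wedge_wedge, wedge_tmul, wedge_tmul, ad_mul]
  simp

/-- The differential of the standard complex. The recursion that defines it is `d_tmul_mul`;
it amounts to the usual explicit formula, which is `d_formula` below. -/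
def d : Module.End ℂ (Space L) :=
  TensorProduct.lift
    (CliffordAlgebra.foldr' (0 : QuadraticForm ℂ L) (dStep L) (dStep_dStep L) 0).flip

variable {L}

theorem d_tmul_one (a : U L) : d L (a ⊗ₜ[ℂ] 1) = 0 := by
  have h := CliffordAlgebra.foldr'_algebraMap (Q := (0 : QuadraticForm ℂ L)) (dStep L)
    (dStep_dStep L) 0 1
  rw [map_one, one_smul] at h
  exact congrArg (fun A : U L →ₗ[ℂ] Space L => A a) h

theorem d_tmul_mul (a : U L) (x : L) (μ : Ext L) :
    d L (a ⊗ₜ[ℂ] (ex x * μ)) =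
      (a * inc x) ⊗ₜ[ℂ] μ - a ⊗ₜ[ℂ] (ad L μ x) - wedge x (d L (a ⊗ₜ[ℂ] μ)) := by
  have h := CliffordAlgebra.foldr'_ι_mul (Q := (0 : QuadraticForm ℂ L)) (dStep L)
    (dStep_dStep L) 0 x μ
  exact congrArg (fun A : U L →ₗ[ℂ] Space L => A a) h

/-- The product `v₀ ∧ ... ∧ vₙ₋₁`. -/
abbrev wedges {n : ℕ} (v : Fin n → L) : Ext L := ExteriorAlgebra.ιMulti ℂ n v

theorem wedges_succ {n : ℕ} (v : Fin (n + 1) → L) :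
    wedges v = ex (v 0) * wedges (fun i => v i.succ) := by
  rw [wedges, ExteriorAlgebra.ιMulti_succ_apply]; rfl

theorem ad_wedges (x : L) {n : ℕ} (v : Fin (n + 1) → L) :
    ad L (wedges v) x = ∑ i : Fin (n + 1), (-1 : ℂ) ^ (i : ℕ) •
      (ex ⁅x, v i⁆ * wedges (fun k => v (i.succAbove k))) := by
  induction n with
  | zero =>
    rw [wedges_succ, ad_mul, wedges, ExteriorAlgebra.ιMulti_zero_apply, ad_one]
    simp [wedges]
  | succ n ih =>
    rw [wedges_succ, ad_mul, ih, Fin.sum_univ_succ (n := n + 1)]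
    congr 1
    · simp
    · rw [Finset.mul_sum]
      refine Finset.sum_congr rfl fun i _ => ?_
      rw [wedges_succ (fun k => v (i.succ.succAbove k))]
      simp only [Fin.succ_succAbove_zero, Fin.succ_succAbove_succ, Fin.val_succ, pow_succ]
      rw [mul_smul_comm, ← mul_assoc, ← mul_assoc,
        eq_neg_of_add_eq_zero_left (ExteriorAlgebra.ι_add_mul_swap (v 0) ⁅x, v i.succ⁆)]
      simp

theorem d_tmul_ex (a : U L) (x : L) : d L (a ⊗ₜ[ℂ] ex x) = (a * inc x) ⊗ₜ[ℂ] 1 := by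
  have h := d_tmul_mul a x 1
  rw [mul_one, ad_one, d_tmul_one] at h
  simpa using h

/-- The explicit formula for the differential of the standard complex, with `v` indexed from `0`:
`d (a ⊗ v₀ ∧ ... ∧ vₚ₋₁) = ∑ᵢ (-1)ⁱ a vᵢ ⊗ v₀ ∧ .. v̂ᵢ .. ∧ vₚ₋₁
  + ∑_{j < i} (-1)ⁱ⁺ʲ a ⊗ [vⱼ, vᵢ] ∧ v₀ ∧ .. v̂ⱼ .. v̂ᵢ .. ∧ vₚ₋₁` (here `p = n + 2`; for `p = 0, 1`
see `d_tmul_one` and `d_tmul_ex`). -/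
theorem d_formula (a : U L) {n : ℕ} (v : Fin (n + 2) → L) :
    d L (a ⊗ₜ[ℂ] wedges v) =
      ∑ i : Fin (n + 2), (-1 : ℂ) ^ (i : ℕ) •
        ((a * inc (v i)) ⊗ₜ[ℂ] wedges (fun k => v (i.succAbove k))) +
      ∑ i : Fin (n + 2), ∑ j : Fin (n + 1), if j.castSucc < i then (-1 : ℂ) ^ ((i : ℕ) + (j : ℕ)) •
        (a ⊗ₜ[ℂ] (ex ⁅v j.castSucc, v i⁆ * wedges (fun k => v (i.succAbove (j.succAbove k)))))
        else 0 := by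
  have key : ∀ (b : U L) (x y : L) (μ : Ext L),
      wedge x (b ⊗ₜ[ℂ] (ex y * μ)) = - (b ⊗ₜ[ℂ] (ex y * (ex x * μ))) := by
    intro b x y μ
    rw [wedge_tmul, ← mul_assoc, ← mul_assoc,
      eq_neg_of_add_eq_zero_left (ExteriorAlgebra.ι_add_mul_swap x y), neg_mul,
      TensorProduct.tmul_neg]
  induction n with
  | zero =>
    have e : wedges v = ex (v 0) * ex (v 1) := by
      rw [wedges_succ, wedges_succ, wedges, ExteriorAlgebra.ιMulti_zero_apply, mul_one]; rfl
    have e' : ad L (ex (v 1)) (v 0) = ex ⁅v 0, v 1⁆ := by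
      have h := ad_mul (v 0) (v 1) 1
      rw [mul_one, ad_one] at h; simpa using h
    rw [e, d_tmul_mul, d_tmul_ex, e', wedge_tmul]
    have w1 : ∀ u : Fin 1 → L, wedges u = ex (u 0) := by
      intro u; rw [wedges_succ, wedges, ExteriorAlgebra.ιMulti_zero_apply, mul_one]
    have w0 : ∀ u : Fin 0 → L, wedges u = 1 := fun u => ExteriorAlgebra.ιMulti_zero_apply u
    simp only [w1, w0]
    simp [sub_eq_add_neg]
    abel
  | succ n ih =>
    rw [wedges_succ, d_tmul_mul, ih, ad_wedges, Fin.sum_univ_succ (n := n + 2),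
      Fin.sum_univ_succ (n := n + 2)]
    have h0 : (∑ j : Fin (n + 2), if j.castSucc < (0 : Fin (n + 3)) then
        (-1 : ℂ) ^ (((0 : Fin (n + 3)) : ℕ) + (j : ℕ)) •
        (a ⊗ₜ[ℂ] (ex ⁅v j.castSucc, v 0⁆ *
          wedges (fun k => v ((0 : Fin (n + 3)).succAbove (j.succAbove k))))) else 0) = 0 :=
      Finset.sum_eq_zero fun j _ => if_neg (by simp)
    rw [h0, zero_add]
    have h2 : ∀ i : Fin (n + 2), (∑ j : Fin (n + 2), if j.castSucc < i.succ then
        (-1 : ℂ) ^ ((i.succ : ℕ) + (j : ℕ)) •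
        (a ⊗ₜ[ℂ] (ex ⁅v j.castSucc, v i.succ⁆ *
          wedges (fun k => v (i.succ.succAbove (j.succAbove k))))) else 0) =
        - ((-1 : ℂ) ^ (i : ℕ) • (a ⊗ₜ[ℂ] (ex ⁅v 0, v i.succ⁆ *
          wedges (fun k => v (i.succAbove k).succ)))) -
        wedge (v 0) (∑ j : Fin (n + 1), if j.castSucc < i then (-1 : ℂ) ^ ((i : ℕ) + (j : ℕ)) •
        (a ⊗ₜ[ℂ] (ex ⁅v j.castSucc.succ, v i.succ⁆ *
          wedges (fun k => v (i.succAbove (j.succAbove k)).succ))) else 0) := by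
      intro i
      rw [Fin.sum_univ_succ, sub_eq_add_neg, map_sum, ← Finset.sum_neg_distrib]
      congr 1
      · rw [if_pos (by simp)]
        simp [pow_succ]
      · refine Finset.sum_congr rfl fun j _ => ?_
        have hc : (j.succ.castSucc < i.succ) ↔ (j.castSucc < i) := by
          rw [← Fin.succ_castSucc, Fin.succ_lt_succ_iff]
        by_cases hj : j.castSucc < i
        · rw [if_pos hj, if_pos (hc.2 hj), map_smul, key,
            wedges_succ (fun k => v (i.succ.succAbove (j.succ.succAbove k)))]
          simp only [Fin.succ_succAbove_zero, Fin.succ_succAbove_succ, Fin.val_succ,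
            Fin.succ_castSucc]
          rw [smul_neg, neg_neg]
          congr 1
          ring
        · rw [if_neg hj, if_neg (fun h => hj (hc.1 h))]; simp
    rw [Finset.sum_congr rfl fun i _ => h2 i, Finset.sum_sub_distrib, Finset.sum_neg_distrib,
      map_add, ← map_sum]
    have h3 : wedge (v 0) (∑ i : Fin (n + 2), (-1 : ℂ) ^ (i : ℕ) •
        ((a * inc (v i.succ)) ⊗ₜ[ℂ] wedges (fun k => v (i.succAbove k).succ))) =
        - ∑ i : Fin (n + 2), (-1 : ℂ) ^ (i.succ : ℕ) • ((a * inc (v i.succ)) ⊗ₜ[ℂ]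
          wedges (fun k => v (i.succ.succAbove k))) := by
      rw [map_sum, ← Finset.sum_neg_distrib]
      refine Finset.sum_congr rfl fun i _ => ?_
      rw [map_smul, wedge_tmul, wedges_succ (fun k => v (i.succ.succAbove k))]
      simp only [Fin.succ_succAbove_zero, Fin.succ_succAbove_succ, Fin.val_succ, pow_succ]
      simp
    rw [h3, TensorProduct.tmul_sum]
    simp only [TensorProduct.tmul_smul, Fin.val_zero, pow_zero, one_smul, Fin.zero_succAbove]
    abel

attribute [local instance 100] LieRing.ofAssociativeRing

/-- The endomorphism of `U(L)` induced by an endomorphism of `L`. -/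
def mapU (f : L →ₗ⁅ℂ⁆ L) : U L →ₐ[ℂ] U L :=
  UniversalEnvelopingAlgebra.lift ℂ ((UniversalEnvelopingAlgebra.ι ℂ).comp f)

theorem mapU_inc (f : L →ₗ⁅ℂ⁆ L) (x : L) : mapU f (inc x) = inc (f x) :=
  UniversalEnvelopingAlgebra.lift_ι_apply ℂ _ x

theorem U_hom_ext {f g : U L →ₐ[ℂ] U L} (h : ∀ x : L, f (inc x) = g (inc x)) : f = g :=
  UniversalEnvelopingAlgebra.hom_ext ℂ (LieHom.ext h)

theorem mapU_eq_id (f : L →ₗ⁅ℂ⁆ L) (h : ∀ x, f x = x) : mapU f = 1 :=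
  U_hom_ext fun x => by rw [mapU_inc, h, AlgHom.one_apply]

theorem mapU_comp (f g k : L →ₗ⁅ℂ⁆ L) (h : ∀ x, k x = f (g x)) : mapU f * mapU g = mapU k :=
  U_hom_ext fun x => by rw [AlgHom.mul_apply, mapU_inc, mapU_inc, mapU_inc, h]

/-- The endomorphism of `U(L) ⊗ ⋀ L` induced by an endomorphism of `L`. -/
def mapSpace (f : L →ₗ⁅ℂ⁆ L) : Module.End ℂ (Space L) :=
  TensorProduct.map (mapU f).toLinearMap (ExteriorAlgebra.map (f : L →ₗ[ℂ] L)).toLinearMap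

theorem mapSpace_tmul (f : L →ₗ⁅ℂ⁆ L) (a : U L) (μ : Ext L) :
    mapSpace f (a ⊗ₜ[ℂ] μ) = mapU f a ⊗ₜ[ℂ] ExteriorAlgebra.map (f : L →ₗ[ℂ] L) μ := rfl

theorem mapSpace_eq_id (f : L →ₗ⁅ℂ⁆ L) (h : ∀ x, f x = x) : mapSpace f = 1 := by
  have e : (f : L →ₗ[ℂ] L) = LinearMap.id := LinearMap.ext h
  apply TensorProduct.ext'
  intro a μ
  rw [mapSpace_tmul, mapU_eq_id f h, e, ExteriorAlgebra.map_id]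
  rfl

theorem mapSpace_comp (f g k : L →ₗ⁅ℂ⁆ L) (h : ∀ x, k x = f (g x)) :
    mapSpace f * mapSpace g = mapSpace k := by
  have e : (k : L →ₗ[ℂ] L) = (f : L →ₗ[ℂ] L) ∘ₗ (g : L →ₗ[ℂ] L) := LinearMap.ext h
  apply TensorProduct.ext'
  intro a μ
  rw [Module.End.mul_apply, mapSpace_tmul, mapSpace_tmul, mapSpace_tmul, ← mapU_comp f g k h, e,
    ← ExteriorAlgebra.map_comp_map]
  rfl

variable (L) in
/-- `U(L)` acts on the standard complex by left multiplication in the first factor. -/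
def leftMul : U L →ₐ[ℂ] Module.End ℂ (Space L) :=
  AlgHom.ofLinearMap (LinearMap.rTensorHom (Ext L) ∘ₗ LinearMap.mul ℂ (U L))
    (by apply TensorProduct.ext'; intro b μ; simp)
    (fun a a' => by apply TensorProduct.ext'; intro b μ; simp [mul_assoc])

theorem leftMul_tmul (a b : U L) (μ : Ext L) :
    leftMul L a (b ⊗ₜ[ℂ] μ) = (a * b) ⊗ₜ[ℂ] μ := rfl

end Standard

end StandardComplex

/-! ### Equivariant complexes -/

section Equivariant

open AffineAlgebraicGroup

variable (T : Type u) [Group T] [AffineAlgebraicGroup T]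
  (A : Type v) [Ring A] [Algebra ℂ A]

/-- The operations of an equivariant `(A,T)`-complex, on the sum of the terms of the complex;
the laws are in `IsEquivariant`. -/
structure EquivariantData where
  carrier : Type w
  [addCommGroup : AddCommGroup carrier]
  [module : Module ℂ carrier]
  /-- the term of degree `n` -/
  gr : ℤ → Submodule ℂ carrier
  /-- the differential -/
  d : Module.End ℂ carrier
  /-- the action of the algebra -/
  π : A →ₐ[ℂ] Module.End ℂ carrier
  /-- the action of the group -/
  ν : Representation ℂ T carrier
  /-- the operators `i_ξ` of degree `-1` -/
  i : LieAlg T →ₗ[ℂ] Module.End ℂ carrier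

attribute [instance] EquivariantData.addCommGroup EquivariantData.module

variable {T A}

namespace EquivariantData

/-- The laws of an equivariant `(A,T)`-complex, where `φ` is the action of `T` on `A` and `ψ` the
map from the Lie algebra of `T` to `A` that belong to the Harish-Chandra pair `(A,T)`. An
equivariant `(A,T)`-complex is the same as an `(A,T,N(𝔱))`-module: the DG algebra `N(𝔱)` is
generated by `𝔱` in degree `0`, which acts by `ω = ν - π`, and `𝔱` in degree `-1`, which acts by
the `i_ξ`. -/
structure IsEquivariant (V : EquivariantData.{u, v, w} T A) (φ : T →* (A →ₐ[ℂ] A))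
    (ψ : LieAlg T →ₗ[ℂ] A) : Prop where
  /-- a complex of vector spaces -/
  isInternal : DirectSum.IsInternal V.gr
  d_mem : ∀ (n : ℤ), ∀ x ∈ V.gr n, V.d x ∈ V.gr (n + 1)
  d_d : ∀ x, V.d (V.d x) = 0
  /-- `A` acts by chain maps -/
  π_mem : ∀ (a : A) (n : ℤ), ∀ x ∈ V.gr n, V.π a x ∈ V.gr n
  d_π : ∀ (a : A) (x : V.carrier), V.d (V.π a x) = V.π a (V.d x)
  /-- `T` acts algebraically, by chain maps -/
  ν_mem : ∀ (t : T) (n : ℤ), ∀ x ∈ V.gr n, V.ν t x ∈ V.gr n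
  d_ν : ∀ (t : T) (x : V.carrier), V.d (V.ν t x) = V.ν t (V.d x)
  algebraic : IsAlgebraic V.ν
  /-- the action of `A` is `T`-equivariant -/
  π_equivariant : ∀ (t : T) (a : A) (x : V.carrier), V.π (φ t a) (V.ν t x) = V.ν t (V.π a x)
  i_mem : ∀ (ξ : LieAlg T) (n : ℤ), ∀ x ∈ V.gr n, V.i ξ x ∈ V.gr (n - 1)
  i_π : ∀ (ξ : LieAlg T) (a : A) (x : V.carrier), V.i ξ (V.π a x) = V.π a (V.i ξ x)
  i_equivariant : ∀ (t : T) (ξ : LieAlg T) (x : V.carrier),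
    V.i (Ad t ξ) (V.ν t x) = V.ν t (V.i ξ x)
  i_i : ∀ (ξ η : LieAlg T) (x : V.carrier), V.i ξ (V.i η x) + V.i η (V.i ξ x) = 0
  /-- `d i_ξ + i_ξ d = ν(ξ) - π(ξ)`, written as: `d i_ξ + i_ξ d + π(ξ)` is the differential of the
  action `ν` of the group -/
  cartan : IsDifferential V.ν (fun ξ x => V.d (V.i ξ x) + V.i ξ (V.d x) + V.π (ψ ξ) x)

/-- The complex is exact in every degree. -/
def IsAcyclic (V : EquivariantData.{u, v, w} T A) : Prop :=
  ∀ x, V.d x = 0 → ∃ y, V.d y = x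

universe w'

/-- A morphism of equivariant complexes: a chain map that commutes with all the actions. -/
structure IsMorphism (V : EquivariantData.{u, v, w} T A) (W : EquivariantData.{u, v, w'} T A)
    (f : V.carrier →ₗ[ℂ] W.carrier) : Prop where
  map_mem : ∀ (n : ℤ), ∀ x ∈ V.gr n, f x ∈ W.gr n
  map_d : ∀ x, f (V.d x) = W.d (f x)
  map_π : ∀ a x, f (V.π a x) = W.π a (f x)
  map_ν : ∀ t x, f (V.ν t x) = W.ν t (f x)
  map_i : ∀ ξ x, f (V.i ξ x) = W.i ξ (f x)

/-- Two morphisms are homotopic: `f - g = h d + d h` for a map `h` of degree `-1` that commutes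
with `A` and `T` and anticommutes with the `i_ξ`. -/
def Homotopic (V : EquivariantData.{u, v, w} T A) (W : EquivariantData.{u, v, w'} T A)
    (f g : V.carrier →ₗ[ℂ] W.carrier) : Prop :=
  ∃ h : V.carrier →ₗ[ℂ] W.carrier,
    (∀ (n : ℤ), ∀ x ∈ V.gr n, h x ∈ W.gr (n - 1)) ∧
    (∀ a x, h (V.π a x) = W.π a (h x)) ∧
    (∀ t x, h (V.ν t x) = W.ν t (h x)) ∧
    (∀ ξ x, h (V.i ξ x) = - W.i ξ (h x)) ∧
    ∀ x, f x - g x = h (V.d x) + W.d (h x)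

universe w''

/-- `V` is K-projective (tested on complexes in the universe `w''`): every morphism from `V` to an
acyclic equivariant `(A,T)`-complex is zero in the homotopic category. -/
def IsKProjective (V : EquivariantData.{u, v, w} T A) (φ : T →* (A →ₐ[ℂ] A))
    (ψ : LieAlg T →ₗ[ℂ] A) : Prop :=
  ∀ W : EquivariantData.{u, v, w''} T A, W.IsEquivariant φ ψ → W.IsAcyclic →
    ∀ f : V.carrier →ₗ[ℂ] W.carrier, V.IsMorphism W f → V.Homotopic W f 0

end EquivariantData

end Equivariant

/-! ### The standard complex as an equivariant complex -/

namespace StandardComplex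

section Group

open AffineAlgebraicGroup

variable {T : Type u} {K : Type v} [Group T] [AffineAlgebraicGroup T] [Group K]
  [AffineAlgebraicGroup K]

variable (K) in
/-- The action of `K` on `U(𝔨)` induced by the adjoint action. -/
def UAction : K →* (U (LieAlg K) →ₐ[ℂ] U (LieAlg K)) where
  toFun g := mapU (Ad g)
  map_one' := mapU_eq_id _ Ad_one
  map_mul' g h := (mapU_comp _ _ _ (Ad_mul g h)).symm

variable (K) in
/-- The action of `K` on `U(𝔨) ⊗ ⋀ 𝔨` induced by the adjoint action. -/
def action : Representation ℂ K (Space (LieAlg K)) where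
  toFun g := mapSpace (Ad g)
  map_one' := mapSpace_eq_id _ Ad_one
  map_mul' g h := (mapSpace_comp _ _ _ (Ad_mul g h)).symm

/-- The action of `T` on `U(𝔨)`. -/
def pairAction (γ : AffineAlgebraicGroup.Hom T K) : T →* (U (LieAlg K) →ₐ[ℂ] U (LieAlg K)) :=
  (UAction K).comp γ.toMonoidHom

/-- The map `𝔱 → 𝔨 → U(𝔨)`. -/
def pairMap (γ : AffineAlgebraicGroup.Hom T K) : LieAlg T →ₗ[ℂ] U (LieAlg K) :=
  inc ∘ₗ γ.diff.toLinearMap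

/-- The standard complex `N(𝔨)` with its `(U(𝔨),T,N(𝔱))`-action: `U(𝔨)` acts by left
multiplication, `T` by the adjoint action, and `N(𝔱)` by right multiplication twisted to a left
action. For `ξ` in `𝔱` of degree `-1` and `μ` in `⋀ᵖ 𝔨` this means
`i_ξ (a ⊗ μ) = - (-1)ᵖ a ⊗ μ ∧ ξ = - a ⊗ ξ ∧ μ`. -/
def data (γ : AffineAlgebraicGroup.Hom T K) : EquivariantData T (U (LieAlg K)) where
  carrier := Space (LieAlg K)
  gr := gr (LieAlg K)
  d := d (LieAlg K)
  π := leftMul (LieAlg K)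
  ν := (action K).comp γ.toMonoidHom
  i := - (wedge ∘ₗ γ.diff.toLinearMap)

end Group

end StandardComplex

end

/-! The first half is a Cartan calculus. Let `theta x` send `a ⊗ μ` to `a x ⊗ μ - a ⊗ ad x μ`. The
recursion that defines `d` says exactly that `d (x ∧ z) + x ∧ d z = theta x z` (`d_wedge`). The
elements `a ⊗ 1`, which `d` kills, generate the complex under exterior multiplication, so every
identity for `d` follows from the commutation rules of `wedge` and `theta`. The adjoint action of
`K` has the differential `leftMul (inc X) - theta X` (`hasDifferentialAt_action`). With `i_ξ = -ξ ∧`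
this gives `d i_ξ + i_ξ d = -theta ξ = ν(ξ) - π(ξ)`.

For K-projectivity, reductivity gives a `T`-equivariant projection `p` of `𝔨` along `𝔱` onto a
complement `𝔭`. Then `N(𝔨)` is free over `U(𝔨) ⊗ ⋀ 𝔱` on `⋀ 𝔭`: a map compatible with `U(𝔨)` and all
`i_ξ` is determined by its restriction to `⋀ 𝔭`, and this restriction may be any `T`-equivariant map
of the right degree (`exists_isHomotopyMap`).

The homotopy `h` from a morphism `f` to zero is built by induction on the exterior degree `q` in
`𝔭`. The obstruction `f - (d h + h d)` is again compatible with all operations. If it vanishes on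
`⋀ⁿ 𝔭` for `n < q`, it vanishes on the submodule that these spaces generate. This submodule contains
`d (1 ⊗ ⋀^q 𝔭)`, because only fewer than `q` exterior factors are left there
(`d_mem_relFiltration`). Hence the obstruction takes `⋀^q 𝔭` to cycles of the acyclic target.
Complete reducibility makes the choice of preimages under `d` linear and `T`-equivariant
(`exists_contraction`). Adding this choice to `h` in degree `q` kills the obstruction there. Since
`𝔨` is finite dimensional, finitely many steps suffice. -/

noncomputable section

/-! ### Complete reducibility of algebraic representations of arbitrary dimension -/

namespace AffineAlgebraicGroup

section Reductive

variable {G : Type u} [Group G] [AffineAlgebraicGroup G]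
  {V : Type v} [AddCommGroup V] [Module ℂ V]

/-- Reductivity is defined by representations on spaces in `Type`, so the action on `F` is
transported to a coordinate space `ℂⁿ` by a basis, and the complement found there is carried back.
-/
theorem IsReductive.exists_complement_of_finiteDimensional (hG : IsReductive G)
    {ρ : Representation ℂ G V} {F : Submodule ℂ V} [FiniteDimensional ℂ F]
    (hF : ∀ g, ∀ y ∈ F, ρ g y ∈ F)
    (hreg : ∀ y ∈ F, ∀ φ : Module.Dual ℂ V, coeff ρ φ y ∈ (regular (G := G)))
    {N : Submodule ℂ V} (hN : ∀ g, ∀ y ∈ N, ρ g y ∈ N) (hNF : N ≤ F) :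
    ∃ N' : Submodule ℂ V, (∀ g, ∀ y ∈ N', ρ g y ∈ N') ∧ N ⊓ N' = ⊥ ∧ N ⊔ N' = F := by
  let e : (Fin (Module.finrank ℂ F) → ℂ) ≃ₗ[ℂ] F := (Module.finBasis ℂ F).equivFun.symm
  let j : (Fin (Module.finrank ℂ F) → ℂ) →ₗ[ℂ] V := F.subtype ∘ₗ e.toLinearMap
  have hj : Function.Injective j := F.injective_subtype.comp e.injective
  have hrange : LinearMap.range j = F := by
    rw [LinearMap.range_comp, LinearEquiv.range, Submodule.map_top, Submodule.range_subtype]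
  let σ : Representation ℂ G (Fin (Module.finrank ℂ F) → ℂ) :=
    { toFun := fun g => e.symm.toLinearMap ∘ₗ (ρ g).restrict (hF g) ∘ₗ e.toLinearMap
      map_one' := LinearMap.ext fun x => (LinearEquiv.symm_apply_eq e).2 (Subtype.ext (by simp))
      map_mul' := fun g h => LinearMap.ext fun x =>
        (LinearEquiv.symm_apply_eq e).2 (Subtype.ext (by simp)) }
  have hjσ : ∀ g x, j (σ g x) = ρ g (j x) := by
    intro g x
    simp [j, σ]
  have hσ : IsAlgebraic σ := by
    intro x
    refine ⟨⊤, trivial, inferInstance, fun _ _ _ => trivial, fun y _ φ => ?_⟩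
    obtain ⟨l, hl⟩ := LinearMap.exists_leftInverse_of_injective j (LinearMap.ker_eq_bot.2 hj)
    -- A functional on `ℂⁿ` extends to `V` along a left inverse of `j`, so each coefficient of `σ`
    -- is one of `ρ`.
    have h : coeff σ φ y = coeff ρ (φ ∘ₗ l) (j y) := by
      funext g
      have := LinearMap.congr_fun hl (σ g y)
      simp only [LinearMap.comp_apply, LinearMap.id_apply] at this
      simp only [coeff, LinearMap.comp_apply, ← hjσ, this]
    rw [h]
    exact hreg _ (e y).2 _
  obtain ⟨C, hC, hc⟩ := hG _ σ hσ (N.comap j) (fun g y hy => by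
    rw [Submodule.mem_comap, hjσ]; exact hN g _ hy)
  have hmap : (N.comap j).map j = N := by
    rw [Submodule.map_comap_eq, hrange, inf_eq_right.2 hNF]
  refine ⟨C.map j, ?_, ?_, ?_⟩
  · rintro g _ ⟨x, hx, rfl⟩
    exact ⟨σ g x, hC g x hx, hjσ g x⟩
  · rw [← hmap, ← Submodule.map_inf _ hj, hc.inf_eq_bot, Submodule.map_bot]
  · rw [← hmap, ← Submodule.map_sup, hc.sup_eq_top, Submodule.map_top, hrange]

open Subrepresentation in
/-- An algebraic representation of a reductive group is completely reducible. -/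
theorem IsReductive.exists_complement (hG : IsReductive G) {ρ : Representation ℂ G V}
    (hρ : IsAlgebraic ρ) {N : Submodule ℂ V} (hN : ∀ g, ∀ y ∈ N, ρ g y ∈ N) :
    ∃ N' : Submodule ℂ V, (∀ g, ∀ y ∈ N', ρ g y ∈ N') ∧ IsCompl N N' := by
  choose F hxF hfin hF hreg using hρ
  let P : V → Subrepresentation ρ := fun x => ⟨F x, fun g y hy => hF x g y hy⟩
  -- `V` is the sum of the finite dimensional `F x`. Each is a semisimple module over the group
  -- algebra, and a sum of semisimple submodules is semisimple.
  have hss : ∀ x, IsSemisimpleModule (MonoidAlgebra ℂ G) (asSubmodule (P x)) := by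
    intro x
    rw [isSemisimpleModule_iff, (Submodule.mapIic (asSubmodule (P x))).complementedLattice_iff]
    refine ⟨fun M => ?_⟩
    let R : Subrepresentation ρ := ofSubmodule' M.1
    obtain ⟨N', h1, h2, h3⟩ := hG.exists_complement_of_finiteDimensional
      (hF x) (hreg x) (N := R.toSubmodule)
      (fun g y hy => R.apply_mem_toSubmodule g hy)
      (fun y hy => M.2 hy)
    let Q : Subrepresentation ρ := ⟨N', fun g y hy => h1 g y hy⟩
    have hle : N' ≤ F x := by rw [← h3]; exact le_sup_right
    have hQ : asSubmodule Q ≤ asSubmodule (P x) := fun y hy => hle hy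
    refine ⟨⟨asSubmodule Q, hQ⟩, ?_, ?_⟩
    · rw [disjoint_iff]
      apply Subtype.ext
      change M.1 ⊓ asSubmodule Q = ⊥
      rw [eq_bot_iff]
      intro y hy
      have hy' : (show V from y) ∈ R.toSubmodule ⊓ N' := hy
      rw [h2] at hy'
      exact hy'
    · rw [codisjoint_iff]
      apply Subtype.ext
      change M.1 ⊔ asSubmodule Q = asSubmodule (P x)
      apply le_antisymm (sup_le M.2 hQ)
      intro y hy
      have hy' : (show V from y) ∈ R.toSubmodule ⊔ N' := by rw [h3]; exact hy
      obtain ⟨a, ha, b, hb, hab⟩ := Submodule.mem_sup.1 hy'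
      exact Submodule.mem_sup.2 ⟨a, ha, b, hb, hab⟩
  have htop : ⨆ x, asSubmodule (P x) = ⊤ := by
    rw [eq_top_iff]
    intro x _
    exact (le_iSup (fun x => asSubmodule (P x)) x) (hxF x)
  have := isSemisimpleModule_of_isSemisimpleModule_submodule' hss htop
  have hc : ComplementedLattice (Subrepresentation ρ) :=
    (subrepresentationSubmoduleOrderIso (ρ := ρ)).complementedLattice_iff.2
      (isSemisimpleModule_iff _ _ |>.1 this)
  obtain ⟨Q, hQ⟩ := hc.exists_isCompl ⟨N, fun g y hy => hN g y hy⟩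
  refine ⟨Q.toSubmodule, fun g y hy => Q.apply_mem_toSubmodule g hy, ?_, ?_⟩
  · exact disjoint_iff.2 (congrArg Subrepresentation.toSubmodule hQ.inf_eq_bot)
  · exact codisjoint_iff.2 (congrArg Subrepresentation.toSubmodule hQ.sup_eq_top)

/-- A `G`-equivariant linear section of `d` on the image of a `G`-stable subspace `S`. -/
theorem IsReductive.exists_section (hG : IsReductive G) {ρ : Representation ℂ G V}
    (hρ : IsAlgebraic ρ) (d : Module.End ℂ V) (hd : ∀ g x, d (ρ g x) = ρ g (d x))
    {S : Submodule ℂ V} (hS : ∀ g, ∀ y ∈ S, ρ g y ∈ S) :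
    ∃ s : Module.End ℂ V, ∀ y ∈ S, s (d y) ∈ S ∧ d (s (d y)) = d y ∧
      ∀ g, s (ρ g (d y)) = ρ g (s (d y)) := by
  -- On the stable space `C ⊓ S` the map `d` is injective and has the same image as on `S`, so any
  -- linear left inverse there is a section. It is equivariant on `d S` because `C ⊓ S` is stable;
  -- nothing is claimed outside `d S`.
  obtain ⟨C, hC, hc⟩ := hG.exists_complement hρ (N := S ⊓ LinearMap.ker d)
    (fun g y hy => ⟨hS g y hy.1, by
      rw [SetLike.mem_coe, LinearMap.mem_ker, hd, LinearMap.mem_ker.1 hy.2, map_zero]⟩)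
  have hinj : LinearMap.ker (d ∘ₗ (C ⊓ S).subtype) = ⊥ := by
    rw [LinearMap.ker_eq_bot']
    rintro ⟨y, hyC, hyS⟩ hy
    have h : y ∈ (S ⊓ LinearMap.ker d) ⊓ C := ⟨⟨hyS, hy⟩, hyC⟩
    rw [hc.inf_eq_bot] at h
    exact Subtype.ext h
  obtain ⟨l, hl⟩ := LinearMap.exists_leftInverse_of_injective _ hinj
  have hl' : ∀ y ∈ C ⊓ S, (l (d y) : V) = y := fun y hy =>
    congrArg Subtype.val (LinearMap.congr_fun hl ⟨y, hy⟩)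
  refine ⟨(C ⊓ S).subtype ∘ₗ l, fun y hy => ?_⟩
  have hsup : y ∈ (S ⊓ LinearMap.ker d) ⊔ C := by rw [hc.sup_eq_top]; trivial
  obtain ⟨k, hk, c, hcC, rfl⟩ := Submodule.mem_sup.1 hsup
  have hcS : c ∈ S := by simpa using S.sub_mem hy hk.1
  have hdk : d (k + c) = d c := by rw [map_add, LinearMap.mem_ker.1 hk.2, zero_add]
  simp only [hdk, LinearMap.comp_apply, Submodule.subtype_apply, ← hd]
  rw [hl' c ⟨hcC, hcS⟩]
  exact ⟨hcS, rfl, fun g => hl' _ ⟨hC g c hcC, hS g c hcS⟩⟩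

end Reductive

end AffineAlgebraicGroup

/-! ### Orbit maps and their derivatives -/

namespace AffineAlgebraicGroup

section HasDifferential

variable {G : Type u} [Group G] [AffineAlgebraicGroup G]
  {V : Type v} [AddCommGroup V] [Module ℂ V]

/-- The orbit map `g ↦ ρ g x` is a regular function with values in a finite dimensional subspace,
and `x'` is its derivative at the identity. -/
def HasDifferentialAt (ρ : Representation ℂ G V) (x : V) (x' : LieAlg G → V) : Prop :=
  ∃ (ι : Type) (_ : Fintype ι) (a : ι → Reg G) (v : ι → V),
    (∀ g, ρ g x = ∑ i, (a i : G → ℂ) g • v i) ∧ ∀ X, x' X = ∑ i, tangent X (a i) • v i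

variable {ρ : Representation ℂ G V}

theorem HasDifferentialAt.coeff_eq {x : V} {ι : Type} [Fintype ι] {a : ι → Reg G} {v : ι → V}
    (h : ∀ g, ρ g x = ∑ i, (a i : G → ℂ) g • v i) (φ : Module.Dual ℂ V) :
    coeff ρ φ x = (∑ i, φ (v i) • a i : Reg G) := by
  funext g
  simp [coeff, h, mul_comm]

/-- The span of an orbit is stable and lies in the span of the finitely many `v i`. -/
theorem isAlgebraic_of_hasDifferentialAt (h : ∀ x, ∃ x', HasDifferentialAt ρ x x') :
    IsAlgebraic ρ := by
  intro x
  obtain ⟨x', ι, _, a, v, hv, -⟩ := h x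
  refine ⟨Submodule.span ℂ (Set.range fun g => ρ g x), ?_, ?_, ?_, ?_⟩
  · exact Submodule.subset_span ⟨1, by simp⟩
  · have hle : Submodule.span ℂ (Set.range fun g => ρ g x) ≤ Submodule.span ℂ (Set.range v) := by
      rw [Submodule.span_le]
      rintro _ ⟨g, rfl⟩
      simp only [hv]
      exact Submodule.sum_mem _ fun i _ =>
        Submodule.smul_mem _ _ (Submodule.subset_span ⟨i, rfl⟩)
    have := FiniteDimensional.span_of_finite ℂ (Set.finite_range v)
    exact Submodule.finiteDimensional_of_le hle
  · intro g y hy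
    induction hy using Submodule.span_induction with
    | mem y hy =>
      obtain ⟨h, rfl⟩ := hy
      exact Submodule.subset_span ⟨g * h, by simp⟩
    | zero => simp
    | add y z _ _ hy hz => rw [map_add]; exact Submodule.add_mem _ hy hz
    | smul c y _ hy => rw [map_smul]; exact Submodule.smul_mem _ _ hy
  · intro y _ φ
    obtain ⟨y', ι, _, a, v, hv, -⟩ := h y
    rw [HasDifferentialAt.coeff_eq hv]
    exact Subtype.property _

theorem isDifferential_of_hasDifferentialAt {ρ' : LieAlg G → V → V}
    (h : ∀ x, HasDifferentialAt ρ x (fun X => ρ' X x)) : IsDifferential ρ ρ' := by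
  intro X x φ hφ
  obtain ⟨ι, _, a, v, hv, hv'⟩ := h x
  have e : (⟨coeff ρ φ x, hφ⟩ : Reg G) = ∑ i, φ (v i) • a i :=
    Subtype.ext (HasDifferentialAt.coeff_eq hv φ)
  rw [e, show ρ' X x = _ from hv' X]
  simp [mul_comm]

theorem tangent_mul (X : LieAlg G) (a b : Reg G) :
    tangent X (a * b) = (a : G → ℂ) 1 * tangent X b + (b : G → ℂ) 1 * tangent X a := by
  rw [tangent_apply, Derivation.leibniz]; rfl

namespace HasDifferentialAt

theorem congr {x : V} {x' x'' : LieAlg G → V} (h : HasDifferentialAt ρ x x')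
    (h' : ∀ X, x'' X = x' X) : HasDifferentialAt ρ x x'' := by
  rwa [show x'' = x' from funext h']

theorem of_fixed {x : V} (h : ∀ g, ρ g x = x) : HasDifferentialAt ρ x (fun _ => 0) := by
  refine ⟨Unit, inferInstance, fun _ => 1, fun _ => x, fun g => by simp [h], fun X => ?_⟩
  simp [tangent_apply]

theorem add {x y : V} {x' y' : LieAlg G → V} (hx : HasDifferentialAt ρ x x')
    (hy : HasDifferentialAt ρ y y') : HasDifferentialAt ρ (x + y) (fun X => x' X + y' X) := by
  obtain ⟨ι, _, a, v, hv, hv'⟩ := hx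
  obtain ⟨κ, _, b, w, hw, hw'⟩ := hy
  exact ⟨ι ⊕ κ, inferInstance, Sum.elim a b, Sum.elim v w, fun g => by simp [hv, hw],
    fun X => by simp [hv', hw']⟩

variable {W : Type*} [AddCommGroup W] [Module ℂ W] {σ : Representation ℂ G W}
  {Z : Type*} [AddCommGroup Z] [Module ℂ Z] {τ : Representation ℂ G Z}

theorem map {x : V} {x' : LieAlg G → V} (hx : HasDifferentialAt ρ x x') (f : V →ₗ[ℂ] W)
    (hf : ∀ g x, f (ρ g x) = σ g (f x)) : HasDifferentialAt σ (f x) (fun X => f (x' X)) := by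
  obtain ⟨ι, _, a, v, hv, hv'⟩ := hx
  exact ⟨ι, inferInstance, a, fun i => f (v i), fun g => by simp [← hf, hv],
    fun X => by simp [hv']⟩

/-- The product rule: the orbit map of `β x y` has coordinates `a i * b j`, whose derivatives are
given by `tangent_mul`. -/
theorem map₂ {x : V} {x' : LieAlg G → V} (hx : HasDifferentialAt ρ x x') {y : W}
    {y' : LieAlg G → W} (hy : HasDifferentialAt σ y y') (β : V →ₗ[ℂ] W →ₗ[ℂ] Z)
    (hβ : ∀ g x y, β (ρ g x) (σ g y) = τ g (β x y)) :
    HasDifferentialAt τ (β x y) (fun X => β (x' X) y + β x (y' X)) := by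
  obtain ⟨ι, _, a, v, hv, hv'⟩ := hx
  obtain ⟨κ, _, b, w, hw, hw'⟩ := hy
  have hx1 : x = ∑ i, (a i : G → ℂ) 1 • v i := by rw [← hv, map_one]; rfl
  have hy1 : y = ∑ i, (b i : G → ℂ) 1 • w i := by rw [← hw, map_one]; rfl
  refine ⟨ι × κ, inferInstance, fun p => a p.1 * b p.2, fun p => β (v p.1) (w p.2),
    fun g => ?_, fun X => ?_⟩
  · rw [← hβ, hv, hw]
    simp only [map_sum, map_smul, LinearMap.sum_apply, LinearMap.smul_apply,
      Fintype.sum_prod_type, Finset.smul_sum, smul_smul, Subalgebra.coe_mul, Pi.mul_apply]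
    first | done | (rw [Finset.sum_comm]; simp only [mul_comm])
  · simp only [tangent_mul, hv', hw']
    have h1 : β (∑ i, tangent X (a i) • v i) y =
        ∑ i, ∑ j, ((b j : G → ℂ) 1 * tangent X (a i)) • β (v i) (w j) := by
      conv_lhs => rw [hy1]
      simp only [map_sum, map_smul, LinearMap.sum_apply, LinearMap.smul_apply, Finset.smul_sum,
        smul_smul]
      rw [Finset.sum_comm]
    have h2 : β x (∑ i, tangent X (b i) • w i) =
        ∑ i, ∑ j, ((a i : G → ℂ) 1 * tangent X (b j)) • β (v i) (w j) := by
      conv_lhs => rw [hx1]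
      simp only [map_sum, map_smul, LinearMap.sum_apply, LinearMap.smul_apply, Finset.smul_sum,
        smul_smul]
      rw [Finset.sum_comm]
      simp only [mul_comm]
    rw [h1, h2, Fintype.sum_prod_type, add_comm]
    simp only [add_smul, Finset.sum_add_distrib]

end HasDifferentialAt

end HasDifferential

/-! ### The adjoint representation and its differential -/

section Adjoint

variable {G : Type u} [Group G] [AffineAlgebraicGroup G]

/-- The regular function `x ↦ e x⁻¹`. -/
def invReg (e : Reg G) : Reg G := ⟨fun x => (e : G → ℂ) x⁻¹, inv_regular _ e.2⟩

theorem invReg_apply (e : Reg G) (x : G) : (invReg e : G → ℂ) x = (e : G → ℂ) x⁻¹ := rfl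

theorem exists_reg_mul (f : Reg G) : ∃ (n : ℕ) (a b : Fin n → Reg G),
    ∀ x y, (f : G → ℂ) (x * y) = ∑ i, (a i : G → ℂ) x * (b i : G → ℂ) y := by
  obtain ⟨n, a, b, ha, hb, h⟩ := mul_regular _ f.2
  exact ⟨n, fun i => ⟨a i, ha i⟩, fun i => ⟨b i, hb i⟩, h⟩

/-- If `e (x y) = ∑ aᵢ(x) bᵢ(y)`, then `∑ aᵢ(x) bᵢ(x⁻¹)` is the constant `e 1`, and its derivative
at the identity is the sum of those of `e` and `invReg e`. -/
theorem tangent_invReg (X : LieAlg G) (e : Reg G) : tangent X (invReg e) = - tangent X e := by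
  obtain ⟨n, a, b, h⟩ := exists_reg_mul e
  have h0 : ∑ i, a i * invReg (b i) = algebraMap ℂ (Reg G) ((e : G → ℂ) 1) := by
    apply Subtype.ext; funext x
    have := h x x⁻¹
    rw [mul_inv_cancel] at this
    simp [this, invReg_apply, Algebra.algebraMap_eq_smul_one]
  have h1 : e = ∑ i, (b i : G → ℂ) 1 • a i := by
    apply Subtype.ext; funext x
    have := h x 1
    rw [mul_one] at this
    simp [this, mul_comm]
  have h2 : invReg e = ∑ i, (a i : G → ℂ) 1 • invReg (b i) := by
    apply Subtype.ext; funext x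
    have := h 1 x⁻¹
    rw [one_mul] at this
    simp [this, invReg_apply]
  have h3 := congrArg (tangent X) h0
  have h4 : tangent X (algebraMap ℂ (Reg G) ((e : G → ℂ) 1)) = 0 := by
    rw [tangent_apply, Derivation.map_algebraMap]; rfl
  rw [h4, map_sum] at h3
  simp only [tangent_mul, Finset.sum_add_distrib] at h3
  have h5 : tangent X e = ∑ i, (b i : G → ℂ) 1 * tangent X (a i) := by
    conv_lhs => rw [h1]
    simp only [map_sum, map_smul, smul_eq_mul]
  rw [h5, h2, eq_neg_iff_add_eq_zero, ← h3]
  simp [invReg_apply]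

/-- A point derivation is determined by its values on generators of the algebra, and the regular
functions are finitely generated. -/
theorem exists_generators (G : Type u) [Group G] [AffineAlgebraicGroup G] :
    ∃ (n : ℕ) (f : Fin n → Reg G), ∀ X : LieAlg G, (∀ i, tangent X (f i) = 0) → X = 0 := by
  obtain ⟨s, hs⟩ := fg (G := G)
  have hmem : ∀ a ∈ s, a ∈ (regular (G := G)) := fun a ha => by
    rw [← hs]; exact Algebra.subset_adjoin ha
  refine ⟨s.card, fun i => ⟨s.equivFin.symm i, hmem _ (s.equivFin.symm i).2⟩, fun X hX => ?_⟩
  have key : ∀ (f : G → ℂ) (_ : f ∈ Algebra.adjoin ℂ (s : Set (G → ℂ)))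
      (hf : f ∈ (regular (G := G))), tangent X ⟨f, hf⟩ = 0 := by
    intro f hf
    induction hf using Algebra.adjoin_induction with
    | mem x hx =>
      intro _
      have := hX (s.equivFin ⟨x, hx⟩)
      simpa using this
    | algebraMap c =>
      intro h
      change tangent X (algebraMap ℂ (Reg G) c) = 0
      rw [tangent_apply, Derivation.map_algebraMap]; rfl
    | add x y hx hy ihx ihy =>
      intro h
      rw [hs] at hx hy
      change tangent X (⟨x, hx⟩ + ⟨y, hy⟩) = 0
      rw [map_add, ihx, ihy, add_zero]
    | mul x y hx hy ihx ihy =>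
      intro h
      rw [hs] at hx hy
      change tangent X (⟨x, hx⟩ * ⟨y, hy⟩) = 0
      rw [tangent_mul, ihx, ihy, mul_zero, mul_zero, add_zero]
  refine ext_tangent fun f => ?_
  rw [key f (by rw [hs]; exact f.2) f.2]; rfl

/-- With `f (x y) = ∑ cⱼ(x) eⱼ(y)` the function is `g ↦ ∑ eⱼ(g⁻¹) (X cⱼ)(g)`. Its derivative along
`Y` at the identity is `∑ eⱼ(1) Y (X cⱼ) - ∑ (Y eⱼ) (X cⱼ)`, evaluated there. Since `f = ∑ eⱼ(1) cⱼ`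
and `Y f = ∑ (Y eⱼ)(1) cⱼ`, this is the commutator `Y X - X Y` applied to `f`. -/
theorem exists_tangent_Ad (X : LieAlg G) (f : Reg G) : ∃ F : Reg G,
    (∀ g, (F : G → ℂ) g = tangent (Ad g X) f) ∧ ∀ Y, tangent Y F = tangent ⁅Y, X⁆ f := by
  obtain ⟨n, c, e, h⟩ := exists_reg_mul f
  refine ⟨∑ j, invReg (e j) * X.der (c j), fun g => ?_, fun Y => ?_⟩
  · have h1 : rightTranslate g⁻¹ f = ∑ j, (e j : G → ℂ) g⁻¹ • c j := by
      apply Subtype.ext; funext x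
      simp [rightTranslate_apply, h, mul_comm]
    rw [tangent_apply, Ad_apply, rightTranslate_apply, one_mul, h1]
    simp [invReg_apply]
  · have h1 : f = ∑ j, (e j : G → ℂ) 1 • c j := by
      apply Subtype.ext; funext x
      have := h x 1
      rw [mul_one] at this
      simp [this, mul_comm]
    have h2 : Y.der f = ∑ j, tangent Y (e j) • c j := by
      apply Subtype.ext; funext x
      have : leftTranslate x f = ∑ j, (c j : G → ℂ) x • e j := by
        apply Subtype.ext; funext y
        simp [leftTranslate_apply, h]
      rw [apply_eq_tangent, this]
      simp [mul_comm]
    have h3 : tangent ⁅Y, X⁆ f = tangent Y (X.der f) - tangent X (Y.der f) := by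
      rw [tangent_apply, LieAlg.der_lie]; rfl
    rw [h3, h2]
    nth_rewrite 1 [h1]
    simp only [map_sum, map_smul, Derivation.map_smul, tangent_mul,
      tangent_invReg, smul_eq_mul, Finset.sum_add_distrib, invReg_apply, inv_one]
    simp only [tangent_apply]
    simp [sub_eq_add_neg, mul_comm]

variable (G) in
/-- The adjoint representation. -/
def adjointRep : Representation ℂ G (LieAlg G) where
  toFun g := (Ad g).toLinearMap
  map_one' := LinearMap.ext Ad_one
  map_mul' g h := LinearMap.ext (Ad_mul g h)

theorem adjointRep_apply (g : G) (X : LieAlg G) : adjointRep G g X = Ad g X := rfl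

/-- A linear coordinate system on the Lie algebra given by tangent vectors. -/
theorem exists_tangent_coordinates (G : Type u) [Group G] [AffineAlgebraicGroup G] :
    ∃ (n : ℕ) (f : Fin n → Reg G) (v : Fin n → LieAlg G),
      ∀ X : LieAlg G, X = ∑ i, tangent X (f i) • v i := by
  obtain ⟨n, f, hf⟩ := exists_generators G
  let c : LieAlg G →ₗ[ℂ] (Fin n → ℂ) :=
    { toFun := fun X i => tangent X (f i)
      map_add' := fun _ _ => rfl
      map_smul' := fun _ _ => rfl }
  obtain ⟨l, hl⟩ := LinearMap.exists_leftInverse_of_injective c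
    (LinearMap.ker_eq_bot'.2 fun X hX => hf X fun i => congrFun hX i)
  refine ⟨n, f, fun i => l (Pi.single i 1), fun X => ?_⟩
  have h : l (c X) = X := LinearMap.congr_fun hl X
  have hc : c X = ∑ i, tangent X (f i) • (Pi.single i 1 : Fin n → ℂ) := pi_eq_sum_univ' (c X)
  conv_lhs => rw [← h, hc]
  simp only [map_sum, map_smul]

/-- This bounds the exterior degree and so makes the construction of the homotopy stop. -/
instance : FiniteDimensional ℂ (LieAlg G) := by
  obtain ⟨n, f, v, h⟩ := exists_tangent_coordinates G
  refine Module.Finite.of_fg_top ?_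
  have : Submodule.span ℂ (Set.range v) = ⊤ := by
    rw [eq_top_iff]
    intro X _
    rw [h X]
    exact Submodule.sum_mem _ fun i _ =>
      Submodule.smul_mem _ _ (Submodule.subset_span ⟨i, rfl⟩)
  rw [← this]
  exact Submodule.fg_span (Set.finite_range v)

theorem hasDifferentialAt_adjointRep (X : LieAlg G) :
    HasDifferentialAt (adjointRep G) X (fun Y => ⁅Y, X⁆) := by
  obtain ⟨n, f, v, h⟩ := exists_tangent_coordinates G
  choose F hF hF' using fun i => exists_tangent_Ad X (f i)
  refine ⟨Fin n, inferInstance, F, v, fun g => ?_, fun Y => ?_⟩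
  · rw [adjointRep_apply]
    simp only [hF]
    exact h _
  · simp only [hF']
    exact h _

end Adjoint
end AffineAlgebraicGroup

/-! ### Cartan calculus on the standard complex -/

namespace StandardComplex

section Standard

variable {L : Type u} [LieRing L] [LieAlgebra ℂ L]

theorem Ext.induction {P : Ext L → Prop} (algebraMap : ∀ c : ℂ, P (algebraMap ℂ _ c))
    (mul : ∀ (x : L) (μ : Ext L), P μ → P (ex x * μ)) (add : ∀ μ ν, P μ → P ν → P (μ + ν))
    (μ : Ext L) : P μ :=
  CliffordAlgebra.left_induction (Q := (0 : QuadraticForm ℂ L)) algebraMap add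
    (fun μ x h => mul x μ h) μ

/-- This induction fits `d`, which vanishes on `a ⊗ 1` and is moved past `wedge x` by Cartan's
formula. -/
theorem Space.induction {P : Space L → Prop} (one : ∀ a : U L, P (a ⊗ₜ[ℂ] 1))
    (wedge : ∀ (x : L) (z : Space L), P z → P (wedge x z))
    (add : ∀ z z', P z → P z' → P (z + z')) (z : Space L) : P z := by
  induction z using TensorProduct.induction_on with
  | zero => simpa using one 0
  | add z z' h h' => exact add z z' h h'
  | tmul a μ =>
    induction μ using Ext.induction with
    | algebraMap c =>
      rw [Algebra.algebraMap_eq_smul_one, TensorProduct.tmul_smul, TensorProduct.smul_tmul']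
      exact one _
    | mul x μ h => rw [← wedge_tmul]; exact wedge x _ h
    | add μ ν h h' => rw [TensorProduct.tmul_add]; exact add _ _ h h'

theorem ad_algebraMap (x : L) (c : ℂ) : ad L (algebraMap ℂ (Ext L) c) x = 0 := by
  rw [Algebra.algebraMap_eq_smul_one, map_smul, LinearMap.smul_apply, ad_one, smul_zero]

theorem ad_lie (x y : L) (μ : Ext L) :
    ad L (ad L μ y) x - ad L (ad L μ x) y = ad L μ ⁅x, y⁆ := by
  induction μ using Ext.induction with
  | algebraMap c => simp only [ad_algebraMap, map_zero, LinearMap.zero_apply, sub_zero]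
  | mul z μ h =>
    simp only [ad_mul, map_add, LinearMap.add_apply, ← h, mul_sub, lie_lie, map_sub, sub_mul]
    abel
  | add μ ν h h' => simp only [map_add, LinearMap.add_apply, ← h, ← h']; abel

theorem inc_lie (x y : L) : inc ⁅x, y⁆ = inc x * inc y - inc y * inc x := by
  let : LieRing (U L) := LieRing.ofAssociativeRing
  exact (UniversalEnvelopingAlgebra.ι ℂ).map_lie x y

/-- `a ⊗ μ ↦ a x ⊗ μ - a ⊗ ad x μ`. -/
def theta (x : L) : Module.End ℂ (Space L) :=
  LinearMap.rTensor (Ext L) (LinearMap.mulRight ℂ (inc x)) -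
    LinearMap.lTensor (U L) ((ad L).flip x)

theorem theta_tmul (x : L) (a : U L) (μ : Ext L) :
    theta x (a ⊗ₜ[ℂ] μ) = (a * inc x) ⊗ₜ[ℂ] μ - a ⊗ₜ[ℂ] ad L μ x := rfl

/-- Cartan's homotopy formula. -/
theorem d_wedge (x : L) (z : Space L) : d L (wedge x z) = theta x z - wedge x (d L z) := by
  induction z using TensorProduct.induction_on with
  | zero => simp
  | tmul a μ => rw [wedge_tmul, d_tmul_mul, theta_tmul]
  | add z z' h h' => simp only [map_add, h, h']; abel

theorem theta_wedge (x y : L) (z : Space L) :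
    theta x (wedge y z) = wedge y (theta x z) - wedge ⁅x, y⁆ z := by
  induction z using TensorProduct.induction_on with
  | zero => simp
  | tmul a μ =>
    simp only [wedge_tmul, theta_tmul, ad_mul, map_sub, TensorProduct.tmul_add]; abel
  | add z z' h h' => simp only [map_add, h, h']; abel

/-- The order is reversed because `theta` is a right action: right multiplication on `U(L)` combined
with `-ad`. -/
theorem theta_lie (x y : L) (z : Space L) :
    theta y (theta x z) - theta x (theta y z) = theta ⁅x, y⁆ z := by
  induction z using TensorProduct.induction_on with
  | zero => simp
  | tmul a μ =>
    simp only [theta_tmul, map_sub, ← ad_lie x y μ, inc_lie, mul_sub, TensorProduct.tmul_sub,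
      TensorProduct.sub_tmul, mul_assoc]
    abel
  | add z z' h h' => simp only [map_add, ← h, ← h']; abel

theorem d_theta (x : L) (z : Space L) : d L (theta x z) = theta x (d L z) := by
  induction z using Space.induction with
  | one a => simp [theta_tmul, ad_one, d_tmul_one]
  | wedge y z h =>
    simp only [theta_wedge, d_wedge, map_sub, h, ← theta_lie x y z]
    abel
  | add z z' h h' => simp only [map_add, h, h']

/-- Two uses of Cartan's formula give `d d (x ∧ z) = d (theta x z) - theta x (d z) + x ∧ d d z`. The
first two terms cancel since `theta x` is a chain map. -/
theorem d_d (z : Space L) : d L (d L z) = 0 := by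
  induction z using Space.induction with
  | one a => rw [d_tmul_one, map_zero]
  | wedge x z h => rw [d_wedge, map_sub, d_wedge, d_theta, h]; simp
  | add z z' h h' => simp only [map_add, h, h', add_zero]

theorem wedge_wedge_add_swap (x y : L) (z : Space L) :
    wedge x (wedge y z) + wedge y (wedge x z) = 0 := by
  have h := wedge_wedge (x + y) z
  simp only [map_add, LinearMap.add_apply, wedge_wedge, zero_add, add_zero] at h
  rwa [add_comm]

theorem leftMul_wedge (a : U L) (x : L) (z : Space L) :
    leftMul L a (wedge x z) = wedge x (leftMul L a z) := by
  induction z using TensorProduct.induction_on with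
  | zero => simp
  | tmul b μ => simp only [wedge_tmul, leftMul_tmul]
  | add z z' h h' => simp only [map_add, h, h']

theorem leftMul_theta (a : U L) (x : L) (z : Space L) :
    leftMul L a (theta x z) = theta x (leftMul L a z) := by
  induction z using TensorProduct.induction_on with
  | zero => simp
  | tmul b μ => simp only [theta_tmul, leftMul_tmul, map_sub, mul_assoc]
  | add z z' h h' => simp only [map_add, h, h']

theorem d_leftMul (a : U L) (z : Space L) : d L (leftMul L a z) = leftMul L a (d L z) := by
  induction z using Space.induction with
  | one b => rw [leftMul_tmul, d_tmul_one, d_tmul_one, map_zero]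
  | wedge x z h => simp only [leftMul_wedge, d_wedge, h, map_sub, leftMul_theta]
  | add z z' h h' => simp only [map_add, h, h']

/-! #### Functoriality -/

theorem mapSpace_wedge (f : L →ₗ⁅ℂ⁆ L) (x : L) (z : Space L) :
    mapSpace f (wedge x z) = wedge (f x) (mapSpace f z) := by
  induction z using TensorProduct.induction_on with
  | zero => simp
  | tmul a μ =>
    rw [wedge_tmul, mapSpace_tmul, mapSpace_tmul, wedge_tmul, map_mul, ExteriorAlgebra.map_apply_ι]
    rfl
  | add z z' h h' => simp only [map_add, h, h']

theorem map_ad (f : L →ₗ⁅ℂ⁆ L) (x : L) (μ : Ext L) :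
    ExteriorAlgebra.map (f : L →ₗ[ℂ] L) (ad L μ x) =
      ad L (ExteriorAlgebra.map (f : L →ₗ[ℂ] L) μ) (f x) := by
  induction μ using Ext.induction with
  | algebraMap c => simp [ad_algebraMap]
  | mul y μ h =>
    simp only [ad_mul, map_add, map_mul, ExteriorAlgebra.map_apply_ι, h]
    simp
  | add μ ν h h' => simp only [map_add, LinearMap.add_apply, h, h']

theorem mapSpace_theta (f : L →ₗ⁅ℂ⁆ L) (x : L) (z : Space L) :
    mapSpace f (theta x z) = theta (f x) (mapSpace f z) := by
  induction z using TensorProduct.induction_on with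
  | zero => simp
  | tmul a μ => simp only [theta_tmul, mapSpace_tmul, map_sub, map_mul, mapU_inc, map_ad]
  | add z z' h h' => simp only [map_add, h, h']

theorem d_mapSpace (f : L →ₗ⁅ℂ⁆ L) (z : Space L) :
    d L (mapSpace f z) = mapSpace f (d L z) := by
  induction z using Space.induction with
  | one b => rw [mapSpace_tmul, map_one, d_tmul_one, d_tmul_one, map_zero]
  | wedge x z h => simp only [mapSpace_wedge, d_wedge, h, map_sub, mapSpace_theta]
  | add z z' h h' => simp only [map_add, h, h']

theorem mapSpace_leftMul (f : L →ₗ⁅ℂ⁆ L) (a : U L) (z : Space L) :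
    leftMul L (mapU f a) (mapSpace f z) = mapSpace f (leftMul L a z) := by
  induction z using TensorProduct.induction_on with
  | zero => simp
  | tmul b μ => simp only [mapSpace_tmul, leftMul_tmul, map_mul]
  | add z z' h h' => simp only [map_add, h, h']

/-! #### The grading -/

theorem extPower_induction {P : ℕ → Ext L → Prop} (one : ∀ c : ℂ, P 0 (algebraMap ℂ _ c))
    (mul : ∀ (n : ℕ) (x : L), ∀ μ ∈ ⋀[ℂ]^n L, P n μ → P (n + 1) (ex x * μ))
    (add : ∀ n, ∀ μ ∈ ⋀[ℂ]^n L, ∀ ν ∈ ⋀[ℂ]^n L, P n μ → P n ν → P n (μ + ν)) {n : ℕ} {μ : Ext L}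
    (hμ : μ ∈ ⋀[ℂ]^n L) : P n μ :=
  Submodule.pow_induction_on_left' (LinearMap.range (ExteriorAlgebra.ι ℂ : L →ₗ[ℂ] Ext L))
    (C := fun n μ _ => P n μ) one (fun μ ν n hμ hν h h' => add n μ hμ ν hν h h')
    (by rintro _ ⟨x, rfl⟩ n μ hμ h; exact mul n x μ hμ h) hμ

theorem ex_mul_mem (x : L) {n : ℕ} {μ : Ext L} (hμ : μ ∈ ⋀[ℂ]^n L) :
    ex x * μ ∈ ⋀[ℂ]^(n + 1) L := by
  change _ ∈ LinearMap.range _ ^ (n + 1)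
  rw [pow_succ']
  exact Submodule.mul_mem_mul ⟨x, rfl⟩ hμ

theorem algebraMap_mem_extPower (c : ℂ) : algebraMap ℂ (Ext L) c ∈ ⋀[ℂ]^0 L := by
  change _ ∈ LinearMap.range _ ^ 0
  rw [pow_zero]
  exact Submodule.algebraMap_mem c

theorem one_mem_extPower : (1 : Ext L) ∈ ⋀[ℂ]^0 L := by
  exact map_one (algebraMap ℂ (Ext L)) ▸ algebraMap_mem_extPower (L := L) 1

theorem map_mem_extPower (f : L →ₗ[ℂ] L) {n : ℕ} {μ : Ext L} (hμ : μ ∈ ⋀[ℂ]^n L) :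
    ExteriorAlgebra.map f μ ∈ ⋀[ℂ]^n L :=
  extPower_induction (P := fun n μ => ExteriorAlgebra.map f μ ∈ ⋀[ℂ]^n L)
    (fun c => by rw [AlgHom.commutes]; exact algebraMap_mem_extPower c)
    (fun n x μ _ h => by rw [map_mul, ExteriorAlgebra.map_apply_ι]; exact ex_mul_mem _ h)
    (fun n μ _ ν _ h h' => by rw [map_add]; exact Submodule.add_mem _ h h') hμ

theorem ad_mem_extPower (x : L) {n : ℕ} {μ : Ext L} (hμ : μ ∈ ⋀[ℂ]^n L) :
    ad L μ x ∈ ⋀[ℂ]^n L :=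
  extPower_induction (P := fun n μ => ad L μ x ∈ ⋀[ℂ]^n L)
    (fun c => by rw [ad_algebraMap]; exact Submodule.zero_mem _)
    (fun n y μ hμ h => by
      rw [ad_mul]; exact Submodule.add_mem _ (ex_mul_mem _ hμ) (ex_mul_mem _ h))
    (fun n μ _ ν _ h h' => by
      rw [map_add, LinearMap.add_apply]; exact Submodule.add_mem _ h h') hμ

theorem tmul_mem_gr (a : U L) {p : ℕ} {μ : Ext L} (hμ : μ ∈ ⋀[ℂ]^p L) :
    a ⊗ₜ[ℂ] μ ∈ gr L (-(p : ℤ)) :=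
  Submodule.subset_span ⟨p, a, μ, rfl, hμ, rfl⟩

theorem gr_le {n : ℤ} {S : Submodule ℂ (Space L)}
    (h : ∀ (p : ℕ) (a : U L), ∀ μ ∈ ⋀[ℂ]^p L, n = -(p : ℤ) → a ⊗ₜ[ℂ] μ ∈ S) : gr L n ≤ S :=
  Submodule.span_le.2 (by rintro _ ⟨p, a, μ, hn, hμ, rfl⟩; exact h p a μ hμ hn)

theorem wedge_mem_gr (x : L) {n : ℤ} {z : Space L} (hz : z ∈ gr L n) :
    wedge x z ∈ gr L (n - 1) := by
  have : gr L n ≤ (gr L (n - 1)).comap (wedge x) := gr_le fun p a μ hμ hn => by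
    have e : n - 1 = -((p + 1 : ℕ) : ℤ) := by rw [hn]; push_cast; ring
    rw [Submodule.mem_comap, wedge_tmul, e]
    exact tmul_mem_gr a (ex_mul_mem x hμ)
  exact this hz

theorem leftMul_mem_gr (a : U L) {n : ℤ} {z : Space L} (hz : z ∈ gr L n) :
    leftMul L a z ∈ gr L n := by
  have : gr L n ≤ (gr L n).comap (leftMul L a) := gr_le fun p b μ hμ hn => by
    rw [Submodule.mem_comap, leftMul_tmul, hn]
    exact tmul_mem_gr _ hμ
  exact this hz

theorem mapSpace_mem_gr (f : L →ₗ⁅ℂ⁆ L) {n : ℤ} {z : Space L} (hz : z ∈ gr L n) :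
    mapSpace f z ∈ gr L n := by
  have : gr L n ≤ (gr L n).comap (mapSpace f) := gr_le fun p b μ hμ hn => by
    rw [Submodule.mem_comap, mapSpace_tmul, hn]
    exact tmul_mem_gr _ (map_mem_extPower _ hμ)
  exact this hz

theorem d_mem_gr {n : ℤ} {z : Space L} (hz : z ∈ gr L n) : d L z ∈ gr L (n + 1) := by
  have : gr L n ≤ (gr L (n + 1)).comap (d L) := gr_le fun p a μ hμ hn => by
    rw [Submodule.mem_comap, hn]
    refine extPower_induction (P := fun p μ => d L (a ⊗ₜ[ℂ] μ) ∈ gr L (-(p : ℤ) + 1))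
      (fun c => ?_) (fun p x μ hμ h => ?_) (fun p μ _ ν _ h h' => ?_) hμ
    · rw [Algebra.algebraMap_eq_smul_one, TensorProduct.tmul_smul, map_smul, d_tmul_one, smul_zero]
      exact Submodule.zero_mem _
    · have e : -((p + 1 : ℕ) : ℤ) + 1 = -(p : ℤ) := by push_cast; ring
      rw [e, d_tmul_mul]
      refine Submodule.sub_mem _ (Submodule.sub_mem _ (tmul_mem_gr _ hμ)
        (tmul_mem_gr _ (ad_mem_extPower x hμ))) ?_
      simpa using wedge_mem_gr x h
    · rw [TensorProduct.tmul_add, map_add]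
      exact Submodule.add_mem _ h h'
  exact this hz

/-- Scaling `L` by `2` separates the exterior powers by its eigenvalues; used for the directness of
the grading. -/
theorem map_two_of_mem_extPower {n : ℕ} {μ : Ext L} (hμ : μ ∈ ⋀[ℂ]^n L) :
    ExteriorAlgebra.map ((2 : ℂ) • (LinearMap.id : L →ₗ[ℂ] L)) μ = (2 : ℂ) ^ n • μ :=
  extPower_induction
    (P := fun n μ => ExteriorAlgebra.map ((2 : ℂ) • (LinearMap.id : L →ₗ[ℂ] L)) μ =
      (2 : ℂ) ^ n • μ)
    (fun c => by rw [AlgHom.commutes, pow_zero, one_smul])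
    (fun n x μ _ h => by
      rw [map_mul, ExteriorAlgebra.map_apply_ι, h]
      simp [pow_succ, smul_smul])
    (fun n μ _ ν _ h h' => by rw [map_add, h, h', smul_add]) hμ

theorem isInternal_gr : DirectSum.IsInternal (gr L) := by
  rw [DirectSum.isInternal_submodule_iff_iSupIndep_and_iSup_eq_top]
  constructor
  · have h := Module.End.eigenspaces_iSupIndep (LinearMap.lTensor (U L)
      (ExteriorAlgebra.map ((2 : ℂ) • (LinearMap.id : L →ₗ[ℂ] L))).toLinearMap)
    -- The term of degree `n = -p` lies in the eigenspace for `2ᵖ`, and these numbers are distinct.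
    have hinj : Function.Injective (fun n : ℤ => (2 : ℂ) ^ (-n)) := by
      intro m n hmn
      have h1 := congrArg (fun z : ℂ => ‖z‖) hmn
      simp only [norm_zpow, Complex.norm_ofNat] at h1
      have := zpow_right_injective₀ (by norm_num : (0 : ℝ) < 2) (by norm_num) h1
      simpa using this
    refine (h.comp hinj).mono fun n => gr_le fun p a μ hμ hn => ?_
    simp only [Function.comp_apply]
    rw [Module.End.mem_eigenspace_iff, LinearMap.lTensor_tmul, AlgHom.toLinearMap_apply,
      map_two_of_mem_extPower hμ, TensorProduct.tmul_smul, hn, neg_neg, zpow_natCast]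
  · rw [eq_top_iff]
    intro z _
    induction z using Space.induction with
    | one a =>
      refine (le_iSup (gr L) 0) ?_
      simpa using tmul_mem_gr a (one_mem_extPower (L := L))
    | wedge x z h =>
      have : ⨆ n, gr L n ≤ (⨆ n, gr L n).comap (wedge x) :=
        iSup_le fun n z hz => (le_iSup (gr L) (n - 1)) (wedge_mem_gr x hz)
      exact this (h trivial)
    | add z z' h h' => exact Submodule.add_mem _ (h trivial) (h' trivial)

end Standard
end StandardComplex

/-! ### The differential of the adjoint action; the standard complex is equivariant -/

namespace StandardComplex

theorem U.induction {L : Type u} [LieRing L] [LieAlgebra ℂ L] {P : U L → Prop}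
    (algebraMap : ∀ c : ℂ, P (algebraMap ℂ _ c)) (inc : ∀ x : L, P (inc x))
    (mul : ∀ a b, P a → P b → P (a * b)) (add : ∀ a b, P a → P b → P (a + b)) (a : U L) : P a := by
  have hs : Function.Surjective (UniversalEnvelopingAlgebra.mkAlgHom ℂ L) :=
    Quotient.mk_surjective
  obtain ⟨t, rfl⟩ := hs a
  induction t using TensorAlgebra.induction with
  | algebraMap c => rw [AlgHom.commutes]; exact algebraMap c
  | ι x => exact inc x
  | mul s t hs ht => rw [map_mul]; exact mul _ _ hs ht
  | add s t hs ht => rw [map_add]; exact add _ _ hs ht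

open AffineAlgebraicGroup

section Differential

variable {K : Type v} [Group K] [AffineAlgebraicGroup K]

variable (K) in
/-- The adjoint representation on `U(𝔨)`. -/
def URep : Representation ℂ K (U (LieAlg K)) where
  toFun g := (mapU (Ad g)).toLinearMap
  map_one' := by rw [mapU_eq_id _ Ad_one]; rfl
  map_mul' g h := by rw [← mapU_comp _ _ _ (Ad_mul g h)]; rfl

variable (K) in
/-- The adjoint representation on `⋀ 𝔨`. -/
def extRep : Representation ℂ K (Ext (LieAlg K)) where
  toFun g := (ExteriorAlgebra.map (Ad g).toLinearMap).toLinearMap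
  map_one' := by
    have e : (Ad (1 : K)).toLinearMap = LinearMap.id := LinearMap.ext Ad_one
    rw [e, ExteriorAlgebra.map_id]; rfl
  map_mul' g h := by
    have e : (Ad (g * h)).toLinearMap = (Ad g).toLinearMap ∘ₗ (Ad h).toLinearMap :=
      LinearMap.ext (Ad_mul g h)
    rw [e, ← ExteriorAlgebra.map_comp_map]; rfl

theorem hasDifferentialAt_URep (a : U (LieAlg K)) :
    HasDifferentialAt (URep K) a (fun X => inc X * a - a * inc X) := by
  induction a using U.induction with
  | algebraMap c =>
    exact (HasDifferentialAt.of_fixed (fun g => AlgHom.commutes (mapU (Ad g)) c)).congr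
      fun X => by rw [Algebra.commutes, sub_self]
  | inc x =>
    exact ((hasDifferentialAt_adjointRep x).map (σ := URep K) inc
      (fun g y => (mapU_inc (Ad g) y).symm)).congr fun X => (inc_lie X x).symm
  | mul a b ha hb =>
    exact (ha.map₂ hb (LinearMap.mul ℂ (U (LieAlg K))) (τ := URep K)
      (fun g x y => (map_mul (mapU (Ad g)) x y).symm)).congr fun X => by
        rw [LinearMap.mul_apply', LinearMap.mul_apply']
        noncomm_ring
  | add a b ha hb =>
    exact (ha.add hb).congr fun X => by noncomm_ring

theorem hasDifferentialAt_extRep (μ : Ext (LieAlg K)) :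
    HasDifferentialAt (extRep K) μ (fun X => ad (LieAlg K) μ X) := by
  induction μ using Ext.induction with
  | algebraMap c =>
    exact (HasDifferentialAt.of_fixed
      (fun g => AlgHom.commutes (ExteriorAlgebra.map (Ad g).toLinearMap) c)).congr
      fun X => ad_algebraMap X c
  | mul x μ h =>
    have hx := (hasDifferentialAt_adjointRep x).map (σ := extRep K) ex
      (fun g y => (ExteriorAlgebra.map_apply_ι (Ad g).toLinearMap y).symm)
    exact (hx.map₂ h (LinearMap.mul ℂ (Ext (LieAlg K))) (τ := extRep K)
      (fun g x y => (map_mul (ExteriorAlgebra.map (Ad g).toLinearMap) x y).symm)).congr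
      fun X => ad_mul X x μ
  | add μ ν h h' =>
    exact (h.add h').congr fun X => by rw [map_add]; rfl

/-- The product rule gives `(X a - a X) ⊗ μ + a ⊗ ad X μ`, and the last two terms make up `-theta
X`. -/
theorem hasDifferentialAt_action (z : Space (LieAlg K)) :
    HasDifferentialAt (action K) z (fun X => leftMul _ (inc X) z - theta X z) := by
  induction z using TensorProduct.induction_on with
  | zero =>
    exact (HasDifferentialAt.of_fixed (fun g => map_zero _)).congr fun X => by simp
  | tmul a μ =>
    exact ((hasDifferentialAt_URep a).map₂ (hasDifferentialAt_extRep μ)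
      (TensorProduct.mk ℂ _ _) (τ := action K) (fun g a μ => rfl)).congr fun X => by
        rw [leftMul_tmul, theta_tmul, TensorProduct.mk_apply, TensorProduct.mk_apply,
          TensorProduct.sub_tmul]
        abel
  | add z z' h h' =>
    exact (h.add h').congr fun X => by simp only [map_add]; abel

end Differential

section Pair

variable {T : Type u} {K : Type v} [Group T] [AffineAlgebraicGroup T] [Group K]
  [AffineAlgebraicGroup K]

theorem _root_.AffineAlgebraicGroup.HasDifferentialAt.comp_hom (γ : AffineAlgebraicGroup.Hom T K)
    {V : Type w} [AddCommGroup V] [Module ℂ V] {ρ : Representation ℂ K V} {x : V}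
    {x' : LieAlg K → V} (h : HasDifferentialAt ρ x x') :
    HasDifferentialAt (ρ.comp γ.toMonoidHom) x (fun ξ => x' (γ.diff ξ)) := by
  obtain ⟨ι, _, a, v, hv, hv'⟩ := h
  refine ⟨ι, inferInstance, fun i => γ.pullback (a i), v, fun t => hv _, fun ξ => ?_⟩
  refine (hv' _).trans (Finset.sum_congr rfl fun i _ => ?_)
  rw [← Hom.tangent_diffFun]; rfl

theorem _root_.AffineAlgebraicGroup.Hom.diff_Ad (γ : AffineAlgebraicGroup.Hom T K) (t : T)
    (ξ : LieAlg T) : γ.diff (Ad t ξ) = Ad (γ.toMonoidHom t) (γ.diff ξ) := by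
  apply ext_tangent
  intro f
  change tangent (γ.diffFun _) f = _
  rw [Hom.tangent_diffFun, tangent_apply, Ad_apply, tangent_apply, Ad_apply, rightTranslate_apply,
    rightTranslate_apply, one_mul, one_mul]
  change _ = ((γ.diffFun ξ).der _ : K → ℂ) _
  rw [← Hom.pullback_apply, Hom.pullback_diffFun]
  have h : rightTranslate t⁻¹ (γ.pullback f) =
      γ.pullback (rightTranslate (γ.toMonoidHom t)⁻¹ f) := by
    apply Subtype.ext; funext s
    simp [rightTranslate_apply, Hom.pullback_apply]
  rw [h]

theorem isEquivariant_data (γ : AffineAlgebraicGroup.Hom T K) :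
    (data γ).IsEquivariant (pairAction γ) (pairMap γ) where
  isInternal := isInternal_gr
  d_mem n x hx := d_mem_gr hx
  d_d x := d_d x
  π_mem a n x hx := leftMul_mem_gr a hx
  d_π a x := d_leftMul a x
  ν_mem t n x hx := mapSpace_mem_gr _ hx
  d_ν t x := d_mapSpace _ x
  algebraic := isAlgebraic_of_hasDifferentialAt fun x =>
    ⟨_, (hasDifferentialAt_action x).comp_hom γ⟩
  π_equivariant t a x := mapSpace_leftMul _ a x
  i_mem ξ n x hx := Submodule.neg_mem _ (wedge_mem_gr _ hx)
  i_π ξ a (x : Space (LieAlg K)) :=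
    (congrArg Neg.neg (leftMul_wedge a (γ.diff ξ) x).symm).trans (map_neg (leftMul _ a) _).symm
  i_equivariant t ξ (x : Space (LieAlg K)) := by
    have h := mapSpace_wedge (Ad (γ.toMonoidHom t)) (γ.diff ξ) x
    rw [← Hom.diff_Ad] at h
    exact (congrArg Neg.neg h.symm).trans (map_neg (mapSpace _) _).symm
  i_i ξ η (x : Space (LieAlg K)) := by
    have h := wedge_wedge_add_swap (γ.diff ξ) (γ.diff η) x
    have e : ∀ (y y' : LieAlg K), -wedge y (-wedge y' x) = wedge y (wedge y' x) := fun y y' => by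
      rw [map_neg, neg_neg]
    exact (congrArg₂ (· + ·) (e _ _) (e _ _)).trans h
  -- Since `i_ξ` is minus the wedge, `d i_ξ + i_ξ d = -theta ξ`; adding `π(ξ)` gives the
  -- differential of the action.
  cartan := isDifferential_of_hasDifferentialAt fun (x : Space (LieAlg K)) =>
    ((hasDifferentialAt_action x).comp_hom γ).congr fun ξ => by
      have h : d _ (-wedge (γ.diff ξ) x) + -wedge (γ.diff ξ) (d _ x) +
          leftMul _ (inc (γ.diff ξ)) x = leftMul _ (inc (γ.diff ξ)) x - theta (γ.diff ξ) x := by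
        rw [map_neg, d_wedge]
        abel
      exact h

end Pair
end StandardComplex

/-! ### Splitting `L` into the image of `𝔱` and a complement: filtration and extension of maps -/

namespace StandardComplex

section Relative

variable {L : Type u} [LieRing L] [LieAlgebra ℂ L] {𝔱 : Type v} [AddCommGroup 𝔱] [Module ℂ 𝔱]

/-- `RelFilt j p q n μ`: the element `μ` of degree `n` is a sum of products of elements of the
image of `j` with exterior products of fewer than `q` elements of the image of `p`. -/
inductive RelFilt (j : 𝔱 →ₗ[ℂ] L) (p : L →ₗ[ℂ] L) (q : ℕ) : ℕ → Ext L → Prop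
  | base {n : ℕ} {μ : Ext L} (hn : n < q) (hμ : μ ∈ ⋀[ℂ]^n L) :
      RelFilt j p q n (ExteriorAlgebra.map p μ)
  | add {n : ℕ} {μ ν : Ext L} : RelFilt j p q n μ → RelFilt j p q n ν → RelFilt j p q n (μ + ν)
  | mul {n : ℕ} {μ : Ext L} (ξ : 𝔱) : RelFilt j p q n μ → RelFilt j p q (n + 1) (ex (j ξ) * μ)

variable {j : 𝔱 →ₗ[ℂ] L} {p : L →ₗ[ℂ] L} {r : L →ₗ[ℂ] 𝔱}

namespace RelFilt

theorem mono {q q' n : ℕ} (hq : q ≤ q') {μ : Ext L} (h : RelFilt j p q n μ) :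
    RelFilt j p q' n μ := by
  induction h with
  | base hn hμ => exact base (hn.trans_le hq) hμ
  | add _ _ h h' => exact add h h'
  | mul ξ _ h => exact mul ξ h

/-- A new factor `p x` is moved past the factors `j ξ`, each time with a sign, until it meets the
product from the image of `p`. -/
theorem ex_apply_mul (x : L) {q n : ℕ} {μ : Ext L} (h : RelFilt j p q n μ) :
    RelFilt j p (q + 1) (n + 1) (ex (p x) * μ) := by
  induction h with
  | base hn hμ =>
    rw [← ExteriorAlgebra.map_apply_ι, ← map_mul]
    exact base (Nat.succ_lt_succ hn) (ex_mul_mem x hμ)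
  | add _ _ h h' => rw [mul_add]; exact add h h'
  | mul ξ _ h =>
    rw [← mul_assoc, eq_neg_of_add_eq_zero_left (ExteriorAlgebra.ι_add_mul_swap (p x) (j ξ)),
      neg_mul, mul_assoc, ← neg_mul, ← map_neg, ← map_neg]
    exact mul (-ξ) h

theorem ex_mul (hx : ∀ x, j (r x) + p x = x) (x : L) {q n : ℕ} {μ : Ext L}
    (h : RelFilt j p q n μ) : RelFilt j p (q + 1) (n + 1) (ex x * μ) := by
  rw [← hx x, map_add, add_mul]
  exact add ((mul (r x) h).mono q.le_succ) (ex_apply_mul x h)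

theorem of_mem_extPower (hx : ∀ x, j (r x) + p x = x) {n : ℕ} {μ : Ext L}
    (hμ : μ ∈ ⋀[ℂ]^n L) : RelFilt j p (n + 1) n μ :=
  extPower_induction (P := fun n μ => RelFilt j p (n + 1) n μ)
    (fun c => by
      rw [← AlgHom.commutes (ExteriorAlgebra.map p)]
      exact base Nat.zero_lt_one (algebraMap_mem_extPower c))
    (fun n x μ _ h => ex_mul hx x h) (fun n μ _ ν _ h h' => add h h') hμ

end RelFilt

/-- The span of the `a ⊗ μ` with `RelFilt j p q n μ` for some `n`. -/
def relFiltration (j : 𝔱 →ₗ[ℂ] L) (p : L →ₗ[ℂ] L) (q : ℕ) : Submodule ℂ (Space L) :=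
  Submodule.span ℂ {z | ∃ (n : ℕ) (a : U L) (μ : Ext L), RelFilt j p q n μ ∧ z = a ⊗ₜ[ℂ] μ}

theorem tmul_mem_relFiltration (a : U L) {q n : ℕ} {μ : Ext L} (h : RelFilt j p q n μ) :
    a ⊗ₜ[ℂ] μ ∈ relFiltration j p q :=
  Submodule.subset_span ⟨n, a, μ, h, rfl⟩

theorem relFiltration_le {q : ℕ} {S : Submodule ℂ (Space L)}
    (h : ∀ (n : ℕ) (a : U L) (μ : Ext L), RelFilt j p q n μ → a ⊗ₜ[ℂ] μ ∈ S) :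
    relFiltration j p q ≤ S :=
  Submodule.span_le.2 (by rintro _ ⟨n, a, μ, hμ, rfl⟩; exact h n a μ hμ)

theorem relFiltration_mono {q q' : ℕ} (hq : q ≤ q') :
    relFiltration j p q ≤ relFiltration j p q' :=
  relFiltration_le fun _ a _ h => tmul_mem_relFiltration a (h.mono hq)

theorem wedge_mem_relFiltration (hx : ∀ x, j (r x) + p x = x) (x : L) {q : ℕ} {z : Space L}
    (hz : z ∈ relFiltration j p q) : wedge x z ∈ relFiltration j p (q + 1) := by
  have : relFiltration j p q ≤ (relFiltration j p (q + 1)).comap (wedge x) :=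
    relFiltration_le fun n a μ h => by
      rw [Submodule.mem_comap, wedge_tmul]
      exact tmul_mem_relFiltration a (h.ex_mul hx x)
  exact this hz

/-- Only degrees matter: in the recursion for degree `n + 1` the first two terms have exterior
degree `n`, hence at most `n` factors from the complement. So `ad (p x)` need not preserve the
complement. -/
theorem d_mem_relFiltration (hx : ∀ x, j (r x) + p x = x) {n : ℕ} {μ : Ext L}
    (hμ : μ ∈ ⋀[ℂ]^n L) : d L (1 ⊗ₜ[ℂ] ExteriorAlgebra.map p μ) ∈ relFiltration j p n := by
  refine extPower_induction
    (P := fun n μ => d L (1 ⊗ₜ[ℂ] ExteriorAlgebra.map p μ) ∈ relFiltration j p n)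
    (fun c => ?_) (fun n x μ hμ h => ?_) (fun n μ _ ν _ h h' => ?_) hμ
  · rw [AlgHom.commutes, Algebra.algebraMap_eq_smul_one, TensorProduct.tmul_smul, map_smul,
      d_tmul_one, smul_zero]
    exact Submodule.zero_mem _
  · rw [map_mul, ExteriorAlgebra.map_apply_ι, d_tmul_mul]
    have hμ' := map_mem_extPower p hμ
    exact Submodule.sub_mem _ (Submodule.sub_mem _
      (tmul_mem_relFiltration _ (.of_mem_extPower hx hμ'))
      (tmul_mem_relFiltration _ (.of_mem_extPower hx (ad_mem_extPower _ hμ'))))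
      (wedge_mem_relFiltration hx _ h)
  · rw [map_add, TensorProduct.tmul_add, map_add]
    exact Submodule.add_mem _ h h'

variable {W : Type w} [AddCommGroup W] [Module ℂ W]

/-- The filtration step is generated by the `1 ⊗ ⋀ⁿ (p L)` with `n < q` under `U(L)` and the wedges
with `j ξ`, both of which `D` respects. The operators `J` are left free since they are `i` for
homotopies and `-i` for morphisms. -/
theorem eq_zero_of_mem_relFiltration {π : U L →ₐ[ℂ] Module.End ℂ W} {J : 𝔱 → Module.End ℂ W}
    {D : Space L →ₗ[ℂ] W} (hπ : ∀ a z, D (leftMul L a z) = π a (D z))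
    (hJ : ∀ ξ z, D (wedge (j ξ) z) = J ξ (D z)) {q : ℕ}
    (hD : ∀ n < q, ∀ μ ∈ ⋀[ℂ]^n L, D (1 ⊗ₜ[ℂ] ExteriorAlgebra.map p μ) = 0) {z : Space L}
    (hz : z ∈ relFiltration j p q) : D z = 0 := by
  have h1 : ∀ {n : ℕ} {μ : Ext L}, RelFilt j p q n μ → D (1 ⊗ₜ[ℂ] μ) = 0 := by
    intro n μ h
    induction h with
    | base hn hμ => exact hD _ hn _ hμ
    | add _ _ h h' => rw [TensorProduct.tmul_add, map_add, h, h', add_zero]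
    | mul ξ _ h => rw [← wedge_tmul, hJ, h, map_zero]
  have : relFiltration j p q ≤ LinearMap.ker D := relFiltration_le fun n a μ h => by
    rw [LinearMap.mem_ker, ← mul_one a, ← leftMul_tmul, hπ, h1 h, map_zero]
  exact this hz

theorem eq_zero_of_forall_extPower (hx : ∀ x, j (r x) + p x = x)
    {π : U L →ₐ[ℂ] Module.End ℂ W} {J : 𝔱 → Module.End ℂ W}
    {D : Space L →ₗ[ℂ] W} (hπ : ∀ a z, D (leftMul L a z) = π a (D z))
    (hJ : ∀ ξ z, D (wedge (j ξ) z) = J ξ (D z))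
    (hD : ∀ n, ∀ μ ∈ ⋀[ℂ]^n L, D (1 ⊗ₜ[ℂ] ExteriorAlgebra.map p μ) = 0) (z : Space L) :
    D z = 0 := by
  induction z using TensorProduct.induction_on with
  | zero => rw [map_zero]
  | add z z' h h' => rw [map_add, h, h', add_zero]
  | tmul a μ =>
    induction μ using DirectSum.Decomposition.inductionOn (fun n : ℕ => ⋀[ℂ]^n L) with
    | zero => simp
    | add μ ν h h' => rw [TensorProduct.tmul_add, map_add, h, h', add_zero]
    | homogeneous μ =>
      exact eq_zero_of_mem_relFiltration (p := p) hπ hJ (fun n _ => hD n)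
        (tmul_mem_relFiltration a (.of_mem_extPower hx μ.2))

section Coextension

/-- The action of `x = j (r x) + p x` on `⋀ 𝔱 ⊗ ⋀ L` by
`r x ∧ τ ⊗ μ + (-1)ᵏ τ ⊗ p x ∧ μ` for `τ` of degree `k`. -/
def splitWedge (r : L →ₗ[ℂ] 𝔱) (p : L →ₗ[ℂ] L) :
    L →ₗ[ℂ] Module.End ℂ (ExteriorAlgebra ℂ 𝔱 ⊗[ℂ] Ext L) where
  toFun x := TensorProduct.map (LinearMap.mulLeft ℂ (ExteriorAlgebra.ι ℂ (r x))) LinearMap.id +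
    TensorProduct.map (CliffordAlgebra.involute (Q := (0 : QuadraticForm ℂ 𝔱))).toLinearMap
      (LinearMap.mulLeft ℂ (ex (p x)))
  map_add' x y := by
    apply TensorProduct.ext'; intro τ μ
    simp only [LinearMap.add_apply, TensorProduct.map_tmul, LinearMap.mulLeft_apply, map_add,
      add_mul, TensorProduct.add_tmul, TensorProduct.tmul_add]
    abel
  map_smul' c x := by
    apply TensorProduct.ext'; intro τ μ
    simp only [LinearMap.add_apply, LinearMap.smul_apply, TensorProduct.map_tmul,
      LinearMap.mulLeft_apply, map_smul, smul_mul_assoc, TensorProduct.smul_tmul',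
      TensorProduct.tmul_smul, smul_add, RingHom.id_apply]

theorem splitWedge_tmul (x : L) (τ : ExteriorAlgebra ℂ 𝔱) (μ : Ext L) :
    splitWedge r p x (τ ⊗ₜ[ℂ] μ) = (ExteriorAlgebra.ι ℂ (r x) * τ) ⊗ₜ[ℂ] μ +
      CliffordAlgebra.involute (Q := (0 : QuadraticForm ℂ 𝔱)) τ ⊗ₜ[ℂ] (ex (p x) * μ) := rfl

/-- The involution on `⋀ 𝔱` makes the two mixed terms cancel. -/
theorem splitWedge_mul_self (x : L) : splitWedge r p x * splitWedge r p x = 0 := by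
  apply TensorProduct.ext'; intro τ μ
  have h1 : ∀ σ : ExteriorAlgebra ℂ 𝔱,
      ExteriorAlgebra.ι ℂ (r x) * (ExteriorAlgebra.ι ℂ (r x) * σ) = 0 := fun σ => by
    rw [← mul_assoc, ExteriorAlgebra.ι_sq_zero, zero_mul]
  have h2 : ∀ ν : Ext L, ex (p x) * (ex (p x) * ν) = 0 := fun ν => by
    rw [← mul_assoc, ExteriorAlgebra.ι_sq_zero, zero_mul]
  rw [Module.End.mul_apply, splitWedge_tmul, map_add, splitWedge_tmul, splitWedge_tmul, h1, h2,
    map_mul, CliffordAlgebra.involute_ι]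
  simp [TensorProduct.neg_tmul]

/-- The extension of a linear map on `⋀ L` from `⋀ (p L)` to `⋀ L` that intertwines `j ξ ∧` and
`J ξ`. -/
theorem exists_coextension (hrj : ∀ ξ, r (j ξ) = ξ) (hpj : ∀ ξ, p (j ξ) = 0)
    (hrp : ∀ x, r (p x) = 0) (hpp : ∀ x, p (p x) = p x) (J : 𝔱 →ₗ[ℂ] Module.End ℂ W)
    (hJ : ∀ ξ w, J ξ (J ξ w) = 0) (c : Ext L →ₗ[ℂ] W) :
    ∃ Φ : Ext L →ₗ[ℂ] W, (∀ ξ μ, Φ (ex (j ξ) * μ) = J ξ (Φ μ)) ∧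
      ∀ μ, Φ (ExteriorAlgebra.map p μ) = c (ExteriorAlgebra.map p μ) := by
  -- Applying `A μ` to `1 ⊗ 1` realises the splitting `⋀ L → ⋀ 𝔱 ⊗ ⋀ (p L)`. The extension is this
  -- map followed by `τ ⊗ μ ↦ B τ (c μ)`.
  let A : Ext L →ₐ[ℂ] Module.End ℂ (ExteriorAlgebra ℂ 𝔱 ⊗[ℂ] Ext L) :=
    ExteriorAlgebra.lift ℂ ⟨splitWedge r p, splitWedge_mul_self⟩
  have hA : ∀ x, A (ex x) = splitWedge r p x := fun x => ExteriorAlgebra.lift_ι_apply ℂ _ _ _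
  let B : ExteriorAlgebra ℂ 𝔱 →ₐ[ℂ] Module.End ℂ W :=
    ExteriorAlgebra.lift ℂ ⟨J, fun ξ => LinearMap.ext fun w => hJ ξ w⟩
  have hB : ∀ ξ, B (ExteriorAlgebra.ι ℂ ξ) = J ξ := fun x => ExteriorAlgebra.lift_ι_apply ℂ _ _ _
  let m : ExteriorAlgebra ℂ 𝔱 ⊗[ℂ] Ext L →ₗ[ℂ] W :=
    TensorProduct.lift (LinearMap.lcomp ℂ W c ∘ₗ B.toLinearMap)
  have hm : ∀ τ μ, m (τ ⊗ₜ[ℂ] μ) = B τ (c μ) := fun τ μ => rfl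
  have hmJ : ∀ ξ y, m (splitWedge r p (j ξ) y) = J ξ (m y) := by
    intro ξ y
    induction y using TensorProduct.induction_on with
    | zero => simp
    | tmul τ μ =>
      rw [splitWedge_tmul, hpj, hrj, map_zero, zero_mul, TensorProduct.tmul_zero, add_zero, hm, hm,
        map_mul, hB]; rfl
    | add y y' h h' => simp only [map_add, h, h']
  have hp : ∀ μ, A (ExteriorAlgebra.map p μ) (1 ⊗ₜ[ℂ] 1) = 1 ⊗ₜ[ℂ] ExteriorAlgebra.map p μ := by
    intro μ
    induction μ using Ext.induction with
    | algebraMap a =>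
      rw [AlgHom.commutes, AlgHom.commutes, Algebra.algebraMap_eq_smul_one,
        Algebra.algebraMap_eq_smul_one, TensorProduct.tmul_smul]; rfl
    | mul x μ h =>
      rw [map_mul, map_mul, Module.End.mul_apply, h, ExteriorAlgebra.map_apply_ι, hA,
        splitWedge_tmul, hrp, hpp, map_zero, zero_mul, TensorProduct.zero_tmul, zero_add, map_one]
    | add μ ν h h' => simp only [map_add, LinearMap.add_apply, h, h', TensorProduct.tmul_add]
  refine ⟨m ∘ₗ LinearMap.applyₗ (1 ⊗ₜ[ℂ] 1) ∘ₗ A.toLinearMap, fun ξ μ => ?_, fun μ => ?_⟩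
  · change m (A (ex (j ξ) * μ) _) = J ξ (m (A μ _))
    rw [map_mul, hA, Module.End.mul_apply, hmJ]
  · change m (A _ _) = _
    rw [hp, hm, map_one]; rfl

end Coextension

end Relative
end StandardComplex

/-! ### Equivariant maps, retractions and contractions -/

namespace AffineAlgebraicGroup

/-- Functionals separate points, and `φ ∘ h` has the same matrix coefficient at `x` as `φ` at `h x`.
Algebraicity of `σ` makes this coefficient regular. -/
theorem IsDifferential.map {G : Type u} [Group G] [AffineAlgebraicGroup G]
    {V : Type v} [AddCommGroup V] [Module ℂ V] {W : Type w} [AddCommGroup W] [Module ℂ W]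
    {ρ : Representation ℂ G V} {σ : Representation ℂ G W} {ρ' : LieAlg G → V → V}
    {σ' : LieAlg G → W → W} (hρ : IsDifferential ρ ρ') (hσ : IsDifferential σ σ')
    (hσa : IsAlgebraic σ) (h : V →ₗ[ℂ] W) (hh : ∀ g x, h (ρ g x) = σ g (h x)) (X : LieAlg G)
    (x : V) : h (ρ' X x) = σ' X (h x) := by
  rw [← sub_eq_zero, ← Module.forall_dual_apply_eq_zero_iff ℂ]
  intro φ
  have e : coeff ρ (φ ∘ₗ h) x = coeff σ φ (h x) := funext fun g => congrArg φ (hh g x)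
  obtain ⟨F, hF, -, -, hreg⟩ := hσa (h x)
  have h1 := hρ X x (φ ∘ₗ h) (by rw [e]; exact hreg _ hF φ)
  have h2 := hσ X (h x) φ (hreg _ hF φ)
  rw [map_sub, h2, ← LinearMap.comp_apply, h1, sub_eq_zero]
  congr 1
  exact Subtype.ext e

theorem exists_equivariant_retraction {T : Type u} {K : Type v} [Group T] [AffineAlgebraicGroup T]
    [Group K] [AffineAlgebraicGroup K] (γ : Hom T K) (hγ : Function.Injective γ.diff)
    (hT : IsReductive T) : ∃ r : LieAlg K →ₗ[ℂ] LieAlg T, (∀ ξ, r (γ.diff ξ) = ξ) ∧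
      ∀ t x, r (Ad (γ.toMonoidHom t) x) = Ad t (r x) := by
  let j : LieAlg T →ₗ[ℂ] LieAlg K := γ.diff.toLinearMap
  have hj : Function.Injective j := hγ
  have halg : IsAlgebraic ((adjointRep K).comp γ.toMonoidHom) :=
    isAlgebraic_of_hasDifferentialAt fun x => ⟨_, (hasDifferentialAt_adjointRep x).comp_hom γ⟩
  obtain ⟨C, hC, hc⟩ := hT.exists_complement halg (N := LinearMap.range j) (by
    rintro t _ ⟨ξ, rfl⟩
    exact ⟨Ad t ξ, γ.diff_Ad t ξ⟩)
  let e := LinearEquiv.ofInjective j hj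
  let r : LieAlg K →ₗ[ℂ] LieAlg T := LinearMap.ofIsCompl hc e.symm.toLinearMap 0
  have hr1 : ∀ ξ, r (j ξ) = ξ := fun ξ => by
    have h : (e ξ : LieAlg K) = j ξ := rfl
    rw [← h]
    simp [r]
  have hr2 : ∀ x ∈ C, r x = 0 := fun x hx => by
    simpa [r] using LinearMap.ofIsCompl_apply_right hc (φ := e.symm.toLinearMap) (ψ := 0) ⟨x, hx⟩
  refine ⟨r, hr1, fun t x => ?_⟩
  have hx : x ∈ LinearMap.range j ⊔ C := by rw [hc.sup_eq_top]; trivial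
  obtain ⟨_, ⟨ξ, rfl⟩, c, hcC, rfl⟩ := Submodule.mem_sup.1 hx
  have h1 : Ad (γ.toMonoidHom t) (j ξ) = j (Ad t ξ) := (γ.diff_Ad t ξ).symm
  have h2 : r (Ad (γ.toMonoidHom t) c) = 0 := hr2 _ (hC t c hcC)
  rw [map_add, map_add, h1, hr1, map_add, hr1, hr2 c hcC, h2, map_add, map_zero]

end AffineAlgebraicGroup

namespace EquivariantData

open AffineAlgebraicGroup

variable {T : Type u} [Group T] [AffineAlgebraicGroup T] {A : Type v} [Ring A] [Algebra ℂ A]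
  {W : EquivariantData.{u, v, w} T A} {φ : T →* (A →ₐ[ℂ] A)} {ψ : LieAlg T →ₗ[ℂ] A}

/-- Acyclicity gives a preimage of no particular degree. Its component of degree `n - 1` is still a
preimage, because `d` is homogeneous. -/
theorem IsEquivariant.exists_mem_gr (hW : W.IsEquivariant φ ψ) (hac : W.IsAcyclic) {n : ℤ}
    {x : W.carrier} (hx : x ∈ W.gr n) (hdx : W.d x = 0) : ∃ y ∈ W.gr (n - 1), W.d y = x := by
  obtain ⟨y, rfl⟩ := hac x hdx
  let _ := hW.isInternal.chooseDecomposition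
  have key : ∀ y : W.carrier, W.d (DirectSum.decompose W.gr y (n - 1) : W.carrier) =
      (DirectSum.decompose W.gr (W.d y) n : W.carrier) := by
    intro y
    induction y using DirectSum.Decomposition.inductionOn W.gr with
    | zero => simp
    | @homogeneous m y =>
      by_cases h : m = n - 1
      · subst h
        have h2 : W.d y ∈ W.gr n := by simpa using hW.d_mem _ _ y.2
        rw [DirectSum.decompose_of_mem_same _ y.2, DirectSum.decompose_of_mem_same _ h2]
      · rw [DirectSum.decompose_of_mem_ne _ y.2 h,
          DirectSum.decompose_of_mem_ne _ (hW.d_mem _ _ y.2) (by omega), map_zero]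
    | add y y' h h' => simp [DirectSum.decompose_add, h, h']
  exact ⟨_, SetLike.coe_mem (DirectSum.decompose W.gr y (n - 1)), by
    rw [key, DirectSum.decompose_of_mem_same _ hx]⟩

theorem IsEquivariant.exists_contraction (hW : W.IsEquivariant φ ψ) (hac : W.IsAcyclic)
    (hT : IsReductive T) (n : ℤ) : ∃ s : Module.End ℂ W.carrier,
      ∀ x ∈ W.gr n, W.d x = 0 → s x ∈ W.gr (n - 1) ∧ W.d (s x) = x ∧
        ∀ t, s (W.ν t x) = W.ν t (s x) := by
  obtain ⟨s, hs⟩ := hT.exists_section hW.algebraic W.d hW.d_ν (S := W.gr (n - 1))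
    (fun t y hy => hW.ν_mem t _ y hy)
  refine ⟨s, fun x hx hdx => ?_⟩
  obtain ⟨y, hy, rfl⟩ := hW.exists_mem_gr hac hx hdx
  exact hs y hy

end EquivariantData

/-! ### Construction of the homotopy by induction on the exterior degree in the complement -/

namespace StandardComplex

open AffineAlgebraicGroup

variable {T : Type u} {K : Type v} [Group T] [AffineAlgebraicGroup T] [Group K]
  [AffineAlgebraicGroup K] {γ : AffineAlgebraicGroup.Hom T K}
  {W : EquivariantData.{u, v, w} T (U (LieAlg K))}

/-- The maps of degree `-1` from the standard complex that commute with `U(𝔨)` and `T` and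
anticommute with the `i_ξ`. -/
structure IsHomotopyMap (γ : AffineAlgebraicGroup.Hom T K)
    (W : EquivariantData.{u, v, w} T (U (LieAlg K))) (h : Space (LieAlg K) →ₗ[ℂ] W.carrier) :
    Prop where
  map_mem : ∀ n, ∀ z ∈ gr (LieAlg K) n, h z ∈ W.gr (n - 1)
  map_leftMul : ∀ a z, h (leftMul _ a z) = W.π a (h z)
  map_action : ∀ t z, h (action K (γ.toMonoidHom t) z) = W.ν t (h z)
  -- On the standard complex `i_ξ` is minus the wedge, so anticommuting with `i_ξ` carries no sign
  -- here.
  map_wedge : ∀ ξ z, h (wedge (γ.diff ξ) z) = W.i ξ (h z)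

/-- The difference of a morphism `f` and `d h + h d`. -/
def obstruction (f h : Space (LieAlg K) →ₗ[ℂ] W.carrier) : Space (LieAlg K) →ₗ[ℂ] W.carrier :=
  f - (W.d ∘ₗ h + h ∘ₗ d (LieAlg K))

theorem obstruction_apply (f h : Space (LieAlg K) →ₗ[ℂ] W.carrier) (z : Space (LieAlg K)) :
    obstruction f h z = f z - (W.d (h z) + h (d _ z)) := rfl

/-- A map that commutes with the group commutes with the differentials of the actions, and `theta ξ
= π(ξ) - ν(ξ)` on the standard complex. Differentiating equivariance is all that is needed, so `T`
may be disconnected. -/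
theorem IsHomotopyMap.map_theta (hW : W.IsEquivariant (pairAction γ) (pairMap γ))
    {h : Space (LieAlg K) →ₗ[ℂ] W.carrier} (hh : IsHomotopyMap γ W h) (ξ : LieAlg T)
    (z : Space (LieAlg K)) :
    h (theta (γ.diff ξ) z) = - (W.d (W.i ξ (h z)) + W.i ξ (W.d (h z))) := by
  have h1 : IsDifferential ((action K).comp γ.toMonoidHom) (fun ξ z =>
      leftMul _ (inc (γ.diff ξ)) z - theta (γ.diff ξ) z) :=
    isDifferential_of_hasDifferentialAt fun z => (hasDifferentialAt_action z).comp_hom γ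
  have h2 := h1.map hW.cartan hW.algebraic h hh.map_action ξ z
  simp only [map_sub, hh.map_leftMul] at h2
  have h3 : pairMap γ ξ = inc (γ.diff ξ) := rfl
  rw [h3] at h2
  rw [sub_eq_iff_eq_add] at h2
  rw [eq_neg_iff_add_eq_zero]
  have h4 := h2.symm
  rw [add_right_comm, add_eq_right] at h4
  rw [add_comm]; exact h4

section Obstruction

variable {f h : Space (LieAlg K) →ₗ[ℂ] W.carrier}

theorem obstruction_leftMul (hW : W.IsEquivariant (pairAction γ) (pairMap γ))
    (hf : (data γ).IsMorphism W f) (hh : IsHomotopyMap γ W h) (a : U (LieAlg K))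
    (z : Space (LieAlg K)) : obstruction f h (leftMul _ a z) = W.π a (obstruction f h z) := by
  have hfa : f (leftMul _ a z) = W.π a (f z) := hf.map_π a z
  simp only [obstruction_apply, hfa, hh.map_leftMul, d_leftMul, hW.d_π, map_sub, map_add]

theorem obstruction_action (hW : W.IsEquivariant (pairAction γ) (pairMap γ))
    (hf : (data γ).IsMorphism W f) (hh : IsHomotopyMap γ W h) (t : T) (z : Space (LieAlg K)) :
    obstruction f h (action K (γ.toMonoidHom t) z) = W.ν t (obstruction f h z) := by
  have hfa : f (action K (γ.toMonoidHom t) z) = W.ν t (f z) := hf.map_ν t z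
  have hd : d _ (action K (γ.toMonoidHom t) z) = action K (γ.toMonoidHom t) (d _ z) :=
    d_mapSpace _ z
  simp only [obstruction_apply, hfa, hh.map_action, hd, hW.d_ν, map_sub, map_add]

/-- The term `d i_ξ h` from `d h` cancels against the same term from `h (theta ξ z)`, which Cartan's
formula produces in `h d`. -/
theorem obstruction_wedge (hW : W.IsEquivariant (pairAction γ) (pairMap γ))
    (hf : (data γ).IsMorphism W f) (hh : IsHomotopyMap γ W h) (ξ : LieAlg T)
    (z : Space (LieAlg K)) :
    obstruction f h (wedge (γ.diff ξ) z) = (-W.i ξ) (obstruction f h z) := by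
  have hfa : f (wedge (γ.diff ξ) z) = -W.i ξ (f z) := by
    have : f (-wedge (γ.diff ξ) z) = W.i ξ (f z) := hf.map_i ξ z
    rw [← this, map_neg, neg_neg]
  simp only [obstruction_apply, hfa, hh.map_wedge, d_wedge, hh.map_theta hW, map_sub, map_add,
    LinearMap.neg_apply]
  abel

theorem obstruction_d (hW : W.IsEquivariant (pairAction γ) (pairMap γ))
    (hf : (data γ).IsMorphism W f) (z : Space (LieAlg K)) :
    obstruction f h (d _ z) = W.d (obstruction f h z) := by
  have hfa : f (d _ z) = W.d (f z) := hf.map_d z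
  simp only [obstruction_apply, hfa, d_d, hW.d_d, map_sub, map_add, map_zero, add_zero, zero_add]

theorem obstruction_mem (hW : W.IsEquivariant (pairAction γ) (pairMap γ))
    (hf : (data γ).IsMorphism W f) (hh : IsHomotopyMap γ W h) {n : ℤ} {z : Space (LieAlg K)}
    (hz : z ∈ gr _ n) : obstruction f h z ∈ W.gr n := by
  rw [obstruction_apply]
  refine Submodule.sub_mem _ (hf.map_mem n z hz) (Submodule.add_mem _ ?_ ?_)
  · simpa using hW.d_mem _ _ (hh.map_mem n z hz)
  · simpa using hh.map_mem _ _ (d_mem_gr hz)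

end Obstruction

theorem IsHomotopyMap.add {h h' : Space (LieAlg K) →ₗ[ℂ] W.carrier} (hh : IsHomotopyMap γ W h)
    (hh' : IsHomotopyMap γ W h') : IsHomotopyMap γ W (h + h') where
  map_mem n z hz := Submodule.add_mem _ (hh.map_mem n z hz) (hh'.map_mem n z hz)
  map_leftMul a z := by simp only [LinearMap.add_apply, map_add, hh.map_leftMul, hh'.map_leftMul]
  map_action t z := by simp only [LinearMap.add_apply, map_add, hh.map_action, hh'.map_action]
  map_wedge ξ z := by simp only [LinearMap.add_apply, map_add, hh.map_wedge, hh'.map_wedge]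

theorem isHomotopyMap_zero : IsHomotopyMap γ W 0 where
  map_mem _ _ _ := Submodule.zero_mem _
  map_leftMul _ _ := by simp
  map_action _ _ := by simp
  map_wedge _ _ := by simp

variable {r : LieAlg K →ₗ[ℂ] LieAlg T} {p : LieAlg K →ₗ[ℂ] LieAlg K}

/-- Freeness over `U(𝔨) ⊗ ⋀ 𝔱`: only the values of `c` on `⋀ (p 𝔨)` matter. They extend to `Φ` on `⋀
𝔨` by the `i_ξ`, and then to `a ⊗ μ ↦ π(a) Φ(μ)`. -/
theorem exists_isHomotopyMap (hW : W.IsEquivariant (pairAction γ) (pairMap γ))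
    (hr : ∀ ξ, r (γ.diff ξ) = ξ) (hrT : ∀ t x, r (Ad (γ.toMonoidHom t) x) = Ad t (r x))
    (hp : ∀ x, γ.diff (r x) + p x = x) (c : Ext (LieAlg K) →ₗ[ℂ] W.carrier)
    (hcgr : ∀ n, ∀ μ ∈ ⋀[ℂ]^n (LieAlg K), c (ExteriorAlgebra.map p μ) ∈ W.gr (-(n : ℤ) - 1))
    (hcT : ∀ (t : T) (n : ℕ), ∀ μ ∈ ⋀[ℂ]^n (LieAlg K),
      c (extRep K (γ.toMonoidHom t) (ExteriorAlgebra.map p μ)) =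
        W.ν t (c (ExteriorAlgebra.map p μ))) :
    ∃ h, IsHomotopyMap γ W h ∧
      ∀ μ, h (1 ⊗ₜ[ℂ] ExteriorAlgebra.map p μ) = c (ExteriorAlgebra.map p μ) := by
  let j : LieAlg T →ₗ[ℂ] LieAlg K := γ.diff.toLinearMap
  have hp' : ∀ x, p x = x - j (r x) := fun x => eq_sub_of_add_eq' (hp x)
  have hrj : ∀ ξ, r (j ξ) = ξ := hr
  have hpj : ∀ ξ, p (j ξ) = 0 := fun ξ => by rw [hp', hrj, sub_self]
  have hrp : ∀ x, r (p x) = 0 := fun x => by rw [hp', map_sub, hrj, sub_self]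
  have hpp : ∀ x, p (p x) = p x := fun x => by rw [hp' (p x), hrp, map_zero, sub_zero]
  have hpT : ∀ t x, p (Ad (γ.toMonoidHom t) x) = Ad (γ.toMonoidHom t) (p x) := fun t x => by
    have h1 : j (Ad t (r x)) = Ad (γ.toMonoidHom t) (j (r x)) := γ.diff_Ad t (r x)
    rw [hp', hp', hrT, map_sub, h1]
  have hii : ∀ ξ w, W.i ξ (W.i ξ w) = 0 := fun ξ w => by
    have h := hW.i_i ξ ξ w
    rw [← two_smul ℂ, smul_eq_zero] at h
    exact h.resolve_left two_ne_zero
  obtain ⟨Φ, hΦj, hΦp⟩ := exists_coextension (j := j) hr hpj hrp hpp W.i hii c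
  -- Degree and equivariance pass from `⋀ (p 𝔨)` to products with `j ξ`, since `i_ξ` lowers degrees
  -- by one and is equivariant.
  have hrel : ∀ (t : T) {q n : ℕ} {μ : Ext (LieAlg K)}, RelFilt j p q n μ →
      Φ μ ∈ W.gr (-(n : ℤ) - 1) ∧ Φ (extRep K (γ.toMonoidHom t) μ) = W.ν t (Φ μ) := by
    intro t q n μ h
    induction h with
    | @base n μ _ hμ =>
      have e : extRep K (γ.toMonoidHom t) (ExteriorAlgebra.map p μ) =
          ExteriorAlgebra.map p (extRep K (γ.toMonoidHom t) μ) := by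
        change ((ExteriorAlgebra.map _).comp (ExteriorAlgebra.map p)) μ =
          ((ExteriorAlgebra.map p).comp (ExteriorAlgebra.map _)) μ
        rw [ExteriorAlgebra.map_comp_map, ExteriorAlgebra.map_comp_map]
        congr 2
        exact LinearMap.ext fun x => (hpT t x).symm
      refine ⟨by rw [hΦp]; exact hcgr n μ hμ, ?_⟩
      rw [e, hΦp, hΦp, ← e, hcT t n μ hμ]
    | add _ _ h h' =>
      simp only [map_add, h.2, h'.2, and_true]
      exact Submodule.add_mem _ h.1 h'.1
    | @mul n μ ξ _ h =>
      have e : extRep K (γ.toMonoidHom t) (ex (j ξ) * μ) =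
          ex (j (Ad t ξ)) * extRep K (γ.toMonoidHom t) μ := by
        change ExteriorAlgebra.map _ _ = _
        rw [map_mul, ExteriorAlgebra.map_apply_ι]
        have h1 : j (Ad t ξ) = Ad (γ.toMonoidHom t) (j ξ) := γ.diff_Ad t ξ
        rw [h1]; rfl
      rw [e, hΦj, hΦj, h.2, hW.i_equivariant]
      refine ⟨?_, rfl⟩
      have := hW.i_mem ξ _ _ h.1
      convert this using 2
      push_cast; ring
  have hdeg : ∀ n, ∀ μ ∈ ⋀[ℂ]^n (LieAlg K), RelFilt j p (n + 1) n μ := fun n μ hμ =>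
    .of_mem_extPower hp hμ
  have hT : ∀ t μ, Φ (extRep K (γ.toMonoidHom t) μ) = W.ν t (Φ μ) := by
    intro t μ
    induction μ using DirectSum.Decomposition.inductionOn (fun n : ℕ => ⋀[ℂ]^n (LieAlg K)) with
    | zero => simp
    | add μ ν h h' => simp only [map_add, h, h']
    | homogeneous μ => exact (hrel t (hdeg _ _ μ.2)).2
  let h : Space (LieAlg K) →ₗ[ℂ] W.carrier :=
    TensorProduct.lift (LinearMap.lcomp ℂ W.carrier Φ ∘ₗ W.π.toLinearMap)
  have hh : ∀ a μ, h (a ⊗ₜ[ℂ] μ) = W.π a (Φ μ) := fun a μ => rfl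
  refine ⟨h, ⟨fun n => ?_, fun a z => ?_, fun t z => ?_, fun ξ z => ?_⟩, fun μ => ?_⟩
  · have : gr (LieAlg K) n ≤ (W.gr (n - 1)).comap h := gr_le fun m a μ hμ hn => by
      rw [Submodule.mem_comap, hh, hn]
      exact hW.π_mem _ _ _ (hrel 1 (hdeg _ _ hμ)).1
    exact fun z hz => this hz
  · induction z using TensorProduct.induction_on with
    | zero => simp
    | tmul b μ => rw [leftMul_tmul, hh, hh, map_mul]; rfl
    | add z z' hz hz' => simp only [map_add, hz, hz']
  · induction z using TensorProduct.induction_on with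
    | zero => simp
    | tmul b μ =>
      have e : action K (γ.toMonoidHom t) (b ⊗ₜ[ℂ] μ) =
        pairAction γ t b ⊗ₜ[ℂ] extRep K (γ.toMonoidHom t) μ := rfl
      rw [e, hh, hh, hT, hW.π_equivariant]
    | add z z' hz hz' => simp only [map_add, hz, hz']
  · induction z using TensorProduct.induction_on with
    | zero => simp
    | tmul b μ =>
      have e := hΦj ξ μ
      rw [wedge_tmul, hh, hh, hW.i_π]
      exact congrArg _ e
    | add z z' hz hz' => simp only [map_add, hz, hz']
  · rw [hh, map_one, hΦp]; rfl

/-- The inductive step corrects `h` by a homotopy map `k` that is a `T`-equivariant `d`-preimage of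
the obstruction on `⋀^q (p 𝔨)` and zero on the other `⋀ⁿ (p 𝔨)`. -/
theorem exists_obstruction_eq_zero (hW : W.IsEquivariant (pairAction γ) (pairMap γ))
    (hac : W.IsAcyclic) (hT : IsReductive T)
    (hr : ∀ ξ, r (γ.diff ξ) = ξ) (hrT : ∀ t x, r (Ad (γ.toMonoidHom t) x) = Ad t (r x))
    (hp : ∀ x, γ.diff (r x) + p x = x) {f : Space (LieAlg K) →ₗ[ℂ] W.carrier}
    (hf : (data γ).IsMorphism W f) (q : ℕ) :
    ∃ h, IsHomotopyMap γ W h ∧ ∀ n < q, ∀ μ ∈ ⋀[ℂ]^n (LieAlg K),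
      obstruction f h (1 ⊗ₜ[ℂ] ExteriorAlgebra.map p μ) = 0 := by
  induction q with
  | zero => exact ⟨0, isHomotopyMap_zero, fun n hn => absurd hn n.not_lt_zero⟩
  | succ q ih =>
    obtain ⟨h, hh, hq⟩ := ih
    let j : LieAlg T →ₗ[ℂ] LieAlg K := γ.diff.toLinearMap
    obtain ⟨s, hs⟩ := hW.exists_contraction hac hT (-(q : ℤ))
    let b : Ext (LieAlg K) →ₗ[ℂ] W.carrier :=
      obstruction f h ∘ₗ TensorProduct.mk ℂ (U (LieAlg K)) (Ext (LieAlg K)) 1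
    have hb : ∀ μ, b μ = obstruction f h (1 ⊗ₜ[ℂ] μ) := fun μ => rfl
    have hbgr : ∀ μ ∈ ⋀[ℂ]^q (LieAlg K), b μ ∈ W.gr (-(q : ℤ)) := fun μ hμ =>
      obstruction_mem hW hf hh (tmul_mem_gr 1 hμ)
    -- The obstruction is a chain map, and `d` of the argument lies in the filtration step where it
    -- already vanishes.
    have hbd : ∀ μ ∈ ⋀[ℂ]^q (LieAlg K), W.d (b (ExteriorAlgebra.map p μ)) = 0 := fun μ hμ => by
      rw [hb, ← obstruction_d hW hf]
      exact eq_zero_of_mem_relFiltration (j := j) (J := fun ξ => -W.i ξ)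
        (obstruction_leftMul hW hf hh) (obstruction_wedge hW hf hh) hq
        (d_mem_relFiltration (r := r) hp hμ)
    -- Projecting to degree `q` keeps the correction from disturbing the lower degrees.
    let pr := GradedAlgebra.proj (fun n : ℕ => ⋀[ℂ]^n (LieAlg K)) q
    have hpr : ∀ μ ∈ ⋀[ℂ]^q (LieAlg K), pr μ = μ := fun μ hμ =>
      DirectSum.decompose_of_mem_same (fun n : ℕ => ⋀[ℂ]^n (LieAlg K)) hμ
    have hpr' : ∀ n, n ≠ q → ∀ μ ∈ ⋀[ℂ]^n (LieAlg K), pr μ = 0 := fun n hn μ hμ =>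
      DirectSum.decompose_of_mem_ne (fun n : ℕ => ⋀[ℂ]^n (LieAlg K)) hμ hn
    let c : Ext (LieAlg K) →ₗ[ℂ] W.carrier := s ∘ₗ b ∘ₗ pr
    have hc : ∀ μ ∈ ⋀[ℂ]^q (LieAlg K), c μ = s (b μ) := fun μ hμ => by
      simp only [c, LinearMap.comp_apply, hpr μ hμ]
    have hc' : ∀ n, n ≠ q → ∀ μ ∈ ⋀[ℂ]^n (LieAlg K), c μ = 0 := fun n hn μ hμ => by
      simp only [c, LinearMap.comp_apply, hpr' n hn μ hμ, map_zero]
    obtain ⟨k, hk, hkc⟩ := exists_isHomotopyMap hW hr hrT hp c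
      (fun n μ hμ => by
        have hpμ := map_mem_extPower p hμ
        by_cases hn : n = q
        · subst hn
          rw [hc _ hpμ]
          exact (hs _ (hbgr _ hpμ) (hbd μ hμ)).1
        · rw [hc' n hn _ hpμ]
          exact Submodule.zero_mem _)
      (fun t n μ hμ => by
        have hpμ := map_mem_extPower p hμ
        have htμ : extRep K (γ.toMonoidHom t) (ExteriorAlgebra.map p μ) ∈ ⋀[ℂ]^n (LieAlg K) :=
          map_mem_extPower _ hpμ
        by_cases hn : n = q
        · subst hn
          have e : b (extRep K (γ.toMonoidHom t) (ExteriorAlgebra.map p μ)) =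
              W.ν t (b (ExteriorAlgebra.map p μ)) := by
            rw [hb, hb, ← obstruction_action hW hf hh]
            congr 1
            change _ = mapU _ 1 ⊗ₜ[ℂ] _
            rw [map_one]; rfl
          rw [hc _ hpμ, hc _ htμ, e]
          exact (hs _ (hbgr _ hpμ) (hbd μ hμ)).2.2 t
        · rw [hc' n hn _ hpμ, hc' n hn _ htμ, map_zero])
    refine ⟨h + k, hh.add hk, fun n hn μ hμ => ?_⟩
    have hpμ := map_mem_extPower p hμ
    -- For `n ≤ q` the boundary is generated by the `⋀ᵐ (p 𝔨)` with `m < q`, where `k` is zero. So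
    -- the correction changes the obstruction only by `d k`.
    have hkd : k (d _ (1 ⊗ₜ[ℂ] ExteriorAlgebra.map p μ)) = 0 :=
      eq_zero_of_mem_relFiltration (j := j) (J := fun ξ => W.i ξ)
        hk.map_leftMul hk.map_wedge (q := q)
        (fun m hm ν hν => by rw [hkc, hc' m hm.ne _ (map_mem_extPower p hν)])
        (relFiltration_mono (Nat.lt_succ_iff.1 hn) (d_mem_relFiltration (r := r) hp hμ))
    have e : obstruction f (h + k) (1 ⊗ₜ[ℂ] ExteriorAlgebra.map p μ) =
        b (ExteriorAlgebra.map p μ) - W.d (c (ExteriorAlgebra.map p μ)) := by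
      rw [hb, obstruction_apply, obstruction_apply, LinearMap.add_apply, LinearMap.add_apply, hkd,
        hkc, map_add]
      abel
    rw [e]
    by_cases hnq : n = q
    · subst hnq
      rw [hc _ hpμ, (hs _ (hbgr _ hpμ) (hbd μ hμ)).2.1, sub_self]
    · rw [hc' n hnq _ hpμ, map_zero, sub_zero, hb]
      exact hq n (by omega) μ hμ

theorem extPower_eq_bot {n : ℕ} (hn : Module.finrank ℂ (LieAlg K) < n) :
    ⋀[ℂ]^n (LieAlg K) = ⊥ := by
  rw [← Submodule.finrank_eq_zero, exteriorPower.finrank_eq, Nat.choose_eq_zero_of_lt hn]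

theorem isKProjective_data (γ : AffineAlgebraicGroup.Hom T K) (hγ : Function.Injective γ.diff)
    (hT : IsReductive T) :
    EquivariantData.IsKProjective.{u, v, v, w} (data γ) (pairAction γ) (pairMap γ) := by
  intro W hW hac f hf
  obtain ⟨r, hr, hrT⟩ := exists_equivariant_retraction γ hγ hT
  let p : LieAlg K →ₗ[ℂ] LieAlg K := LinearMap.id - γ.diff.toLinearMap ∘ₗ r
  have hp : ∀ x, γ.diff (r x) + p x = x := fun x => add_sub_cancel _ _
  obtain ⟨h, hh, hq⟩ := exists_obstruction_eq_zero hW hac hT hr hrT hp hf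
    -- Exterior powers above the dimension vanish, so the bound `dim 𝔨 + 1` covers all degrees.
    (Module.finrank ℂ (LieAlg K) + 1)
  have hzero : ∀ z, obstruction f h z = 0 :=
    eq_zero_of_forall_extPower (j := γ.diff.toLinearMap) (J := fun ξ => -W.i ξ) hp
      (obstruction_leftMul hW hf hh) (obstruction_wedge hW hf hh) fun n μ hμ => by
        by_cases hn : n < Module.finrank ℂ (LieAlg K) + 1
        · exact hq n hn μ hμ
        · rw [extPower_eq_bot (by omega), Submodule.mem_bot] at hμ
          rw [hμ, map_zero, TensorProduct.tmul_zero, map_zero]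
  refine ⟨h, hh.map_mem, hh.map_leftMul, hh.map_action, fun ξ z => ?_, fun z => ?_⟩
  · exact (map_neg h (wedge (γ.diff ξ) z)).trans (congrArg Neg.neg (hh.map_wedge ξ z))
  · exact (sub_zero _).trans ((sub_eq_zero.1 (hzero z)).trans (add_comm _ _))

end StandardComplex

end

theorem mainTheorem2 {T : Type u} {K : Type v}
    [Group T] [AffineAlgebraicGroup T] [Group K] [AffineAlgebraicGroup K]
    (γ : AffineAlgebraicGroup.Hom T K) (hγ : Function.Injective γ.diff)
    (hT : AffineAlgebraicGroup.IsReductive T) :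
    (StandardComplex.data γ).IsEquivariant
        (StandardComplex.pairAction γ) (StandardComplex.pairMap γ) ∧
      EquivariantData.IsKProjective.{u, v, v, w} (StandardComplex.data γ)
        (StandardComplex.pairAction γ) (StandardComplex.pairMap γ) :=
  ⟨StandardComplex.isEquivariant_data γ, StandardComplex.isKProjective_data γ hγ hT⟩
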